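/- Let $d\ge 2$ and let $U\subseteq\mathbb R^d$ be open and bounded with Lipschitz boundary: $\partial U$ is covered by finitely many open sets $U_1,\dots,U_l$ such that, with respect to an orthonormal basis $e_1^k,\dots,e_d^k$, an open cuboid $I_k\subseteq\mathbb R^{d-1}$, a number $h_k>0$ and a Lipschitz function $\varphi_k:\mathbb R^{d-1}\to\mathbb R$, writing $v=\sum_j v_je_j^k$ and $v'=(v_1,\dots,v_{d-1})$, $$U_k=\{v:\ v'\in I_k,\ |v_d-\varphi_k(v')|<h_k\},$$ and a point $v\in U_k$ lies in $\partial U$ if $v_d=\varphi_k(v')$, in $U$ if $v_d>\varphi_k(v')$ and in $\overline U^{\,c}$ if $v_d<\varphi_k(v')$. Put $A=\partial U$ and let $S$ be the surface measure on $A$, extended by zero to $\mathbb R^d$, $$S(F)=\sum_{k=1}^l\int_{I_k}(\eta_k1_F)\Big(\sum_{j<d}v_je_j^k+\varphi_k(v)e_d^k\Big)\sqrt{1+|\nabla\varphi_k(v)|^2}\,dv ,$$ where $(\eta_k)$ is a smooth partition of unity on $A$ with $\operatorname{supp}\eta_k\subseteq U_k$. Let $\nu$ be the outer unit normal to $U$,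 which exists $S$-almost everywhere on $A$ and is given in a chart by $\nu=(1+|\nabla\varphi_k|^2)^{-1/2}\big(\sum_{j<d}\partial_j\varphi_k\,e_j^k-e_d^k\big)$. Let $\varrho:\mathbb R^d\to(0,\infty)$ be continuously differentiable and $\mu=\lambda^d+S$, with $\lambda^d$ the Lebesgue measure. Let $(\mathcal E^\varrho,D(\mathcal E^\varrho))$ be the closure in $L^2(\mathbb R^d,\varrho\mu)$ of the form $\mathcal E^\varrho(u,v)=\int_{\mathbb R^d}\langle\nabla u,\nabla v\rangle\,\varrho\,d\lambda^d$, $u,v\in C_c^\infty(\mathbb R^d)$, and let $(L^\varrho,D(L^\varrho))$ be its generator: $f\in D(L^\varrho)$ with $L^\varrho f=w\in L^2(\mathbb R^d,\varrho\mu)$ if and only if $f\in D(\mathcal E^\varrho)$ and $\mathcal E^\varrho(f,g)=-(w,g)_{L^2(\varrho\mu)}$ for all $g\in D(\mathcal E^\varrho)$. Let $f:\mathbb R^d\to\mathbb R$ be continuous with compact support and twice continuously differentiable on $\mathbb R^d\setminus A$, where $f$ and its derivatives up to order two are bounded. Then at every $x\in A$ the limits $(\nabla f)^{ext}_{U}(x)$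 and $(\nabla f)^{ext}_{\overline U^{\,c}}(x)$ of $\nabla f(y)$ as $y\to x$ with $y\in U$, respectively $y\in\overline U^{\,c}$, exist. Moreover $f\in L^2(\mathbb R^d,\varrho\mu)$, $f\in D(L^\varrho)$, and $\varrho\mu$-almost everywhere $$L^\varrho f=1_{\mathbb R^d\setminus A}\big(\Delta f+\langle\nabla f,\nabla\ln\varrho\rangle\big)+1_A\Big((\partial_\nu f)^{ext}_{\overline U^{\,c}}-(\partial_\nu f)^{ext}_U\Big),$$ where $(\partial_\nu f)^{ext}_V=\langle(\nabla f)^{ext}_V,\nu\rangle$ on $A$ for $V\in\{U,\overline U^{\,c}\}$. -/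

import Mathlib

open MeasureTheory Filter Topology Set
open scoped ContDiff Manifold ENNReal

noncomputable section

/-- Euclidean space `ℝ^d`. -/
abbrev Space (d : ℕ) := EuclideanSpace ℝ (Fin d)

/-! ### Sets with Lipschitz boundary -/

/-- The data of a local graph representation in `ℝ^d`, `d = n + 1`: an orthonormal basis
`e_1, …, e_d`, an open cuboid `I = ∏ (a_j, b_j) ⊆ ℝ^{d-1}`, a height `h > 0` and a Lipschitz
continuous function `φ : ℝ^{d-1} → ℝ`. -/
structure GraphChart (n : ℕ) where
  basis : OrthonormalBasis (Fin (n + 1)) ℝ (Space (n + 1))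
  lower : Fin n → ℝ
  upper : Fin n → ℝ
  height : ℝ
  height_pos : 0 < height
  φ : Space n → ℝ
  lipschitz : ∃ K, LipschitzWith K φ

namespace GraphChart

variable {n : ℕ} (c : GraphChart n)

/-- The first `d - 1` coordinates of `x` with respect to the basis of the chart. -/
def horiz (x : Space (n + 1)) : Space n := WithLp.toLp 2 fun j => c.basis.repr x j.castSucc

/-- The last coordinate of `x` with respect to the basis of the chart. -/
def vert (x : Space (n + 1)) : ℝ := c.basis.repr x (Fin.last n)

/-- The open cuboid `I`. -/
def box : Set (Space n) := {v | ∀ j, c.lower j < v j ∧ v j < c.upper j}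

/-- The open set `{∑ v_j e_j | (v_1, …, v_{d-1}) ∈ I, |v_d - φ(v_1, …, v_{d-1})| < h}`. -/
def nbhd : Set (Space (n + 1)) :=
  {x | c.horiz x ∈ c.box ∧ |c.vert x - c.φ (c.horiz x)| < c.height}

/-- The graph parametrisation `v ↦ ∑_{j < d} v_j e_j + φ(v) e_d`. -/
def graphMap (v : Space n) : Space (n + 1) :=
  ∑ j, v j • c.basis j.castSucc + c.φ v • c.basis (Fin.last n)

/-- The surface element `√(1 + |∇φ|²)`; by Rademacher's theorem the gradient of the Lipschitz
function `φ` exists almost everywhere and represents the weak gradient. -/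
def surfaceElement (v : Space n) : ℝ := Real.sqrt (1 + ‖gradient c.φ v‖ ^ 2)

/-- The vector `(1 + |∇φ|²)^{-1/2} (∑_{j < d} ∂_jφ e_j - e_d)`. -/
def normal (v : Space n) : Space (n + 1) :=
  (c.surfaceElement v)⁻¹ •
    (∑ j, gradient c.φ v j • c.basis j.castSucc - c.basis (Fin.last n))

/-- In the neighbourhood of the chart, `∂U` is the graph of `φ`, the set `U` lies above it and
the complement of the closure of `U` lies below it. -/
def IsChartOf (U : Set (Space (n + 1))) : Prop :=
  ∀ x ∈ c.nbhd,
    (c.vert x = c.φ (c.horiz x) → x ∈ frontier U) ∧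
    (c.φ (c.horiz x) < c.vert x → x ∈ U) ∧
    (c.vert x < c.φ (c.horiz x) → x ∈ (closure U)ᶜ)

end GraphChart

/-- A finite family of charts of `U` whose neighbourhoods cover `∂U`. A (bounded open) set has
Lipschitz boundary if it admits such an atlas. -/
structure LipschitzAtlas {n : ℕ} (U : Set (Space (n + 1))) where
  size : ℕ
  chart : Fin size → GraphChart n
  isChart : ∀ k, (chart k).IsChartOf U
  cover : frontier U ⊆ ⋃ k, (chart k).nbhd

/-- The surface measure `F ↦ ∑_k ∫_{I_k} (η_k 1_F)(v, φ_k(v)) √(1 + |∇φ_k(v)|²) dv` on `∂U`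
(extended by zero to `ℝ^d`), for a partition of unity `(η_k)` on `∂U`. -/
def surfaceMeasure {n : ℕ} {U : Set (Space (n + 1))} (𝒜 : LipschitzAtlas U)
    (η : SmoothPartitionOfUnity (Fin 𝒜.size) 𝓘(ℝ, Space (n + 1)) (Space (n + 1)) (frontier U)) :
    Measure (Space (n + 1)) :=
  ∑ k, ((volume.restrict (𝒜.chart k).box).withDensity fun v =>
      ENNReal.ofReal (η k ((𝒜.chart k).graphMap v) * (𝒜.chart k).surfaceElement v)).map
    (𝒜.chart k).graphMap

/-- `ν` is the outer unit normal to `U` at the boundary point `x`, computed in some chart of `U`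
around `x` whose graph function is differentiable at the point below `x`. Such a `ν` does not
depend on the chart, and it exists for almost every boundary point. -/
def IsOuterNormalAt {n : ℕ} (U : Set (Space (n + 1))) (x ν : Space (n + 1)) : Prop :=
  ∃ c : GraphChart n, c.IsChartOf U ∧ x ∈ frontier U ∧ x ∈ c.nbhd ∧
    DifferentiableAt ℝ c.φ (c.horiz x) ∧ ν = c.normal (c.horiz x)

open Classical in
/-- The outer unit normal `ν_U` (zero where there is none, on a set of surface measure zero). -/
def outerNormal {n : ℕ} (U : Set (Space (n + 1))) (x : Space (n + 1)) : Space (n + 1) :=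
  if h : ∃ ν, IsOuterNormalAt U x ν then h.choose else 0

/-- The extension of `∇f` to a boundary point `x` by its limit from within `V`. -/
def gradientFrom {d : ℕ} (V : Set (Space d)) (f : Space d → ℝ) (x : Space d) : Space d :=
  limUnder (𝓝[V] x) (gradient f)

/-- The normal derivative `(∂_ν f)^{ext}_V = ∑_i (∂_i f)^{ext}_V ν_i` at a point of `∂U`, with
the derivatives of `f` extended from within `V` and `ν` the outer unit normal to `U`. -/
def normalDerivFrom {n : ℕ} (U V : Set (Space (n + 1))) (f : Space (n + 1) → ℝ)
    (x : Space (n + 1)) : ℝ :=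
  inner ℝ (gradientFrom V f x) (outerNormal U x)

/-- `f` is twice continuously differentiable on the open set `O`, and `f` and its derivatives
up to order two are bounded on `O`. -/
def IsBoundedC2On {d : ℕ} (f : Space d → ℝ) (O : Set (Space d)) : Prop :=
  ContDiffOn ℝ 2 f O ∧ ∀ j ≤ 2, ∃ C : ℝ, ∀ x ∈ O, ‖iteratedFDeriv ℝ j f x‖ ≤ C

/-! ### The Dirichlet form and its generator -/

section Form

variable {d : ℕ}

/-- The measure `ρμ` with `μ = λ^d + S`. -/
def weightedMeasure (S : Measure (Space d)) (ρ : Space d → ℝ) : Measure (Space d) :=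
  (volume + S).withDensity fun x => ENNReal.ofReal (ρ x)

/-- `u ∈ C_c^∞(ℝ^d)`. -/
def IsTestFunction (u : Space d → ℝ) : Prop := ContDiff ℝ ∞ u ∧ HasCompactSupport u

/-- The pre-Dirichlet form `(u, v) ↦ ∫ ⟨∇u, ∇v⟩ ρ dλ^d` on `C_c^∞(ℝ^d)`. -/
def preForm (ρ : Space d → ℝ) (u v : Space d → ℝ) : ℝ :=
  ∫ x, inner ℝ (gradient u x) (gradient v x) * ρ x

/-- `(u_k)` is a sequence of test functions which converges to `f` in `L²(ρμ)` and is Cauchy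
for the form. -/
def IsApproximation (S : Measure (Space d)) (ρ : Space d → ℝ)
    (f : Lp ℝ 2 (weightedMeasure S ρ)) (u : ℕ → Space d → ℝ) : Prop :=
  (∀ k, IsTestFunction (u k)) ∧
  (∃ hu : ∀ k, MemLp (u k) 2 (weightedMeasure S ρ),
    Tendsto (fun k => (hu k).toLp (u k)) atTop (𝓝 f)) ∧
  Tendsto (fun p : ℕ × ℕ => preForm ρ (u p.1 - u p.2) (u p.1 - u p.2)) atTop (𝓝 0)

/-- The domain of the closure of the form in `L²(ρμ)`. -/
def formDomain (S : Measure (Space d)) (ρ : Space d → ℝ) :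
    Set (Lp ℝ 2 (weightedMeasure S ρ)) :=
  {f | ∃ u, IsApproximation S ρ f u}

open Classical in
/-- The closure of the form: `ℰ(f, g) = lim_k ℰ(u_k, v_k)` for approximating sequences `(u_k)` of
`f` and `(v_k)` of `g`. As the form is closable, the limit does not depend on the sequences. -/
def closedForm (S : Measure (Space d)) (ρ : Space d → ℝ)
    (f g : Lp ℝ 2 (weightedMeasure S ρ)) : ℝ :=
  if h : f ∈ formDomain S ρ ∧ g ∈ formDomain S ρ then
    limUnder atTop fun k => preForm ρ (h.1.choose k) (h.2.choose k)
  else 0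

/-- `f ∈ D(ℰ)` and `ℰ(f, g) = (-w, g)` for all `g ∈ D(ℰ)`. -/
def IsGeneratorValue (S : Measure (Space d)) (ρ : Space d → ℝ)
    (f w : Lp ℝ 2 (weightedMeasure S ρ)) : Prop :=
  f ∈ formDomain S ρ ∧ ∀ g ∈ formDomain S ρ, closedForm S ρ f g = inner ℝ (-w) g

/-- The domain of the generator. -/
def generatorDomain (S : Measure (Space d)) (ρ : Space d → ℝ) :
    Set (Lp ℝ 2 (weightedMeasure S ρ)) :=
  {f | ∃ w, IsGeneratorValue S ρ f w}

open Classical in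
/-- The generator of the closed form; its value is unique because the domain of the form is
dense in `L²(ρμ)`. -/
def generator (S : Measure (Space d)) (ρ : Space d → ℝ)
    (f : Lp ℝ 2 (weightedMeasure S ρ)) : Lp ℝ 2 (weightedMeasure S ρ) :=
  if h : f ∈ generatorDomain S ρ then h.choose else 0

end Form

/-- The function `1_{ℝ^d∖A} (Δf + ⟨∇f, ∇ ln ρ⟩) + 1_A ((∂_ν f)^{ext}_{Ū^c} - (∂_ν f)^{ext}_U)`
with `A = ∂U`. -/
def generatorFormula {n : ℕ} (U : Set (Space (n + 1))) (ρ f : Space (n + 1) → ℝ) :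
    Space (n + 1) → ℝ := fun x =>
  (frontier U)ᶜ.indicator (fun y => Laplacian.laplacian f y +
      inner ℝ (gradient f y) (gradient (fun z => Real.log (ρ z)) y)) x +
    (frontier U).indicator (fun y => normalDerivFrom U (closure U)ᶜ f y -
      normalDerivFrom U U f y) x

end

/-! The formula is the Gauss–Green theorem for the flux `ρ∇f`, which jumps across `A = ∂U`, combined
with closability of the form. Off `A`, div(vρ∇f) = ⟨∇f,∇v⟩ρ + vρ(Δf + ⟨∇f,∇ln ρ⟩) for a test
function v, and integrating the left side leaves a surface integral of vρ times the jump of ∂_νf.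
Because μ charges `A`, this surface term is an honest pairing in L²(ρμ), and
`integral_inner_gradient_eq` reads ∫⟨∇f,∇v⟩ρ = -(w,v) with w = `generatorFormula`.

The divergence theorem is proved in one chart by flattening the graph with `param`, a shear that
preserves Lebesgue measure although φ is only Lipschitz (`integral_fderiv_of_jump`). Tangential
derivatives integrate to zero over the slices parallel to the graph; vertical ones integrate to the
jump. The resulting weight is the surface element times the component of the normal
(`inner_normal`), so the surface measure appears after a partition of unity
(`IsPiecewiseC1.integral_fderiv_mul`). The one-sided traces of ∇f exist since bounded second
derivatives make ∇f Lipschitz near a boundary point on each side (`exists_tendsto_side`).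

For membership in the form domain, continuity of f removes the boundary term when integrating f
itself by parts, so its pointwise gradient is its weak gradient. Mollifications of f then converge
to f everywhere, hence also S-almost everywhere, with gradients converging λ^d-almost everywhere,
all bounded and supported in one compact set (`exists_testFunction_approximation`).

Finally, a limit of gradients along a null sequence is orthogonal to every test gradient, hence to
itself (`gradientLp_limit_eq_zero`). So every approximating sequence of f has the same limiting
gradient, the identity with test functions extends to the whole form domain, and w is the only
possible value because test functions separate L²(ρμ). -/

noncomputable section

/-! ### Graph charts and their flattening coordinates -/

namespace GraphChart

variable {n : ℕ} (c : GraphChart n)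

/-- The coordinates `(v, t) ↦ ∑_{j < d} v_j e_j + (φ(v) + t) e_d`, which flatten the graph. -/
def param (p : Space n × ℝ) : Space (n + 1) :=
  c.graphMap p.1 + p.2 • c.basis (Fin.last n)

lemma continuous_phi : Continuous c.φ := c.lipschitz.choose_spec.continuous

@[fun_prop]
lemma continuous_horiz : Continuous c.horiz := by
  unfold horiz
  fun_prop

@[fun_prop]
lemma continuous_vert : Continuous c.vert := by
  unfold vert
  fun_prop

/-- The horizontal coordinates as a linear map. -/
def horizL : Space (n + 1) →L[ℝ] Space n :=
  LinearMap.toContinuousLinearMap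
    { toFun := c.horiz
      map_add' := fun x y => by ext j; simp [horiz]
      map_smul' := fun a x => by ext j; simp [horiz] }

/-- The vertical coordinate as a linear map. -/
def vertL : Space (n + 1) →L[ℝ] ℝ :=
  LinearMap.toContinuousLinearMap
    { toFun := c.vert
      map_add' := fun x y => by simp [vert]
      map_smul' := fun a x => by simp [vert] }

@[simp] lemma horizL_apply (x : Space (n + 1)) : c.horizL x = c.horiz x := rfl

@[simp] lemma vertL_apply (x : Space (n + 1)) : c.vertL x = c.vert x := rfl

/-- The horizontal embedding `v ↦ ∑_{j < d} v_j e_j`. -/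
def liftL : Space n →L[ℝ] Space (n + 1) :=
  ∑ j : Fin n, (EuclideanSpace.proj j : Space n →L[ℝ] ℝ).smulRight (c.basis j.castSucc)

lemma liftL_apply (v : Space n) : c.liftL v = ∑ j, v j • c.basis j.castSucc := by
  simp [liftL]

lemma param_eq (v : Space n) (t : ℝ) :
    c.param (v, t) = c.liftL v + (c.φ v + t) • c.basis (Fin.last n) := by
  simp [param, graphMap, liftL_apply, add_smul, add_assoc]

lemma graphMap_eq (v : Space n) :
    c.graphMap v = c.liftL v + c.φ v • c.basis (Fin.last n) := by
  simp [graphMap, liftL_apply]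

@[simp] lemma param_zero (v : Space n) : c.param (v, 0) = c.graphMap v := by simp [param]

lemma repr_liftL_castSucc (v : Space n) (j : Fin n) : c.basis.repr (c.liftL v) j.castSucc = v j := by
  simp [liftL_apply, Pi.single_apply]

lemma repr_liftL_last (v : Space n) : c.basis.repr (c.liftL v) (Fin.last n) = 0 := by
  simp [liftL_apply, (Fin.castSucc_ne_last _).symm]

@[simp] lemma horiz_liftL_add (v : Space n) (s : ℝ) :
    c.horiz (c.liftL v + s • c.basis (Fin.last n)) = v := by
  ext j
  have := c.repr_liftL_castSucc v j
  simp [horiz, this, Fin.castSucc_ne_last]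

@[simp] lemma vert_liftL_add (v : Space n) (s : ℝ) :
    c.vert (c.liftL v + s • c.basis (Fin.last n)) = s := by
  have := c.repr_liftL_last v
  simp [vert, this]

@[simp] lemma horiz_param (v : Space n) (t : ℝ) : c.horiz (c.param (v, t)) = v := by
  simp [param_eq]

@[simp] lemma vert_param (v : Space n) (t : ℝ) : c.vert (c.param (v, t)) = c.φ v + t := by
  simp [param_eq]

@[simp] lemma horiz_graphMap (v : Space n) : c.horiz (c.graphMap v) = v := by
  simp [graphMap_eq]

@[simp] lemma vert_graphMap (v : Space n) : c.vert (c.graphMap v) = c.φ v := by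
  simp [graphMap_eq]

lemma eq_liftL_add (x : Space (n + 1)) :
    x = c.liftL (c.horiz x) + c.vert x • c.basis (Fin.last n) := by
  conv_lhs => rw [← c.basis.sum_repr x, Fin.sum_univ_castSucc]
  simp [liftL_apply, horiz, vert]

lemma param_horiz_vert (x : Space (n + 1)) :
    c.param (c.horiz x, c.vert x - c.φ (c.horiz x)) = x := by
  conv_rhs => rw [c.eq_liftL_add x]
  simp [param_eq]

@[fun_prop]
lemma continuous_graphMap : Continuous c.graphMap := by
  have := c.continuous_phi
  unfold graphMap
  fun_prop

@[fun_prop]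
lemma continuous_param : Continuous c.param := by
  unfold param
  fun_prop

/-- `param` as a homeomorphism. -/
def paramHomeo : Space n × ℝ ≃ₜ Space (n + 1) where
  toFun := c.param
  invFun x := (c.horiz x, c.vert x - c.φ (c.horiz x))
  left_inv p := by obtain ⟨v, t⟩ := p; simp
  right_inv x := c.param_horiz_vert x
  continuous_toFun := c.continuous_param
  continuous_invFun := by
    have := c.continuous_phi
    fun_prop

@[simp] lemma paramHomeo_apply (p : Space n × ℝ) : c.paramHomeo p = c.param p := rfl

lemma graphMap_injective : Function.Injective c.graphMap :=
  Function.LeftInverse.injective (g := c.horiz) c.horiz_graphMap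

lemma measurableEmbedding_graphMap : MeasurableEmbedding c.graphMap :=
  c.continuous_graphMap.measurableEmbedding c.graphMap_injective

lemma measurableEmbedding_param : MeasurableEmbedding c.param :=
  c.paramHomeo.measurableEmbedding

/-- An orthonormal basis gives an isometry onto coordinate space, and splitting off the last
coordinate there preserves product measure. -/
lemma measurePreserving_flat : MeasurePreserving
    (fun p : Space n × ℝ => c.liftL p.1 + p.2 • c.basis (Fin.last n))
    (volume.prod volume) volume := by
  have h1 := (volume_preserving_piFinSuccAbove (fun _ : Fin (n + 1) => ℝ) (Fin.last n)).symm
  have h2 : MeasurePreserving (fun p : Space n × ℝ => (p.2, (p.1.ofLp : Fin n → ℝ)))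
      (volume.prod volume) (volume.prod volume) := by
    have hs := MeasureTheory.Measure.measurePreserving_swap (μ := (volume : Measure (Space n)))
      (ν := (volume : Measure ℝ))
    have := (MeasurePreserving.id (volume : Measure ℝ)).prod
      (PiLp.volume_preserving_ofLp (Fin n))
    exact this.comp hs
  have h3 := (PiLp.volume_preserving_toLp (Fin (n + 1))).comp (h1.comp h2)
  have h4 := c.basis.repr.symm.measurePreserving.comp h3
  suffices h : (fun p : Space n × ℝ => c.liftL p.1 + p.2 • c.basis (Fin.last n)) =
      c.basis.repr.symm ∘ WithLp.toLp 2 ∘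
        (MeasurableEquiv.piFinSuccAbove (fun _ : Fin (n + 1) => ℝ) (Fin.last n)).symm ∘
          fun p : Space n × ℝ => (p.2, p.1.ofLp) by
    rw [h]
    exact h4
  funext p
  apply c.basis.repr.injective
  ext i
  simp only [Function.comp_apply, LinearIsometryEquiv.apply_symm_apply]
  refine Fin.lastCases ?_ (fun j => ?_) i
  · have := c.repr_liftL_last p.1
    simp [this, MeasurableEquiv.piFinSuccAbove_symm_apply]
  · have := c.repr_liftL_castSucc p.1 j
    simp [this, MeasurableEquiv.piFinSuccAbove_symm_apply, Fin.castSucc_ne_last]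

/-- On each vertical fibre the flattening is a translation by `φ v`, so no Jacobian and no
smoothness of φ is involved. -/
lemma measurePreserving_param : MeasurePreserving c.param (volume.prod volume) volume := by
  have h1 : MeasurePreserving (fun p : Space n × ℝ => (p.1, c.φ p.1 + p.2))
      (volume.prod volume) (volume.prod volume) := by
    refine (MeasurePreserving.id volume).skew_product (g := fun v t => c.φ v + t) ?_ ?_
    · have := c.continuous_phi.measurable
      fun_prop
    · exact Eventually.of_forall fun v => (measurePreserving_add_left volume (c.φ v)).map_eq
  convert c.measurePreserving_flat.comp h1 using 1
  funext p
  obtain ⟨v, t⟩ := p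
  simp [param_eq]

lemma volume_graph : volume {x | c.vert x = c.φ (c.horiz x)} = 0 := by
  rw [← c.measurePreserving_param.measure_preimage_emb c.measurableEmbedding_param]
  have : c.param ⁻¹' {x | c.vert x = c.φ (c.horiz x)} = univ ×ˢ {0} := by
    ext ⟨v, t⟩
    simp
  rw [this, Measure.prod_prod]
  simp

lemma isOpen_box : IsOpen c.box := by
  have : c.box = ⋂ j, {v : Space n | c.lower j < v j ∧ v j < c.upper j} := by
    ext; simp [box]
  rw [this]
  refine isOpen_iInter_of_finite fun j => ?_
  have h : Continuous fun v : Space n => v j := by fun_prop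
  exact (isOpen_lt continuous_const h).inter (isOpen_lt h continuous_const)

lemma isOpen_nbhd : IsOpen c.nbhd := by
  have := c.continuous_phi
  exact (c.isOpen_box.preimage c.continuous_horiz).inter
    (isOpen_lt (f := fun x => |c.vert x - c.φ (c.horiz x)|) (by fun_prop) continuous_const)

lemma graphMap_mem_nbhd {v : Space n} : c.graphMap v ∈ c.nbhd ↔ v ∈ c.box := by
  simp [nbhd, c.height_pos]

lemma isBounded_box : Bornology.IsBounded c.box := by
  have h : c.box ⊆ WithLp.ofLp ⁻¹' (Set.Icc c.lower c.upper) := by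
    intro v hv
    exact ⟨fun j => (hv j).1.le, fun j => (hv j).2.le⟩
  have hc : IsCompact (WithLp.ofLp ⁻¹' (Set.Icc c.lower c.upper) : Set (Space n)) :=
    (PiLp.homeomorph 2 (fun _ : Fin n => ℝ)).isCompact_preimage.2 isCompact_Icc
  exact hc.isBounded.subset h

variable {c} {U : Set (Space (n + 1))}

/-- A chart provides only implications from the position relative to the graph. The converses here
and below follow by trichotomy, as an open `U`, its frontier and its exterior are disjoint. -/
lemma IsChartOf.mem_frontier_iff (h : c.IsChartOf U) (hU : IsOpen U) {x : Space (n + 1)}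
    (hx : x ∈ c.nbhd) : x ∈ frontier U ↔ c.vert x = c.φ (c.horiz x) := by
  refine ⟨fun hf => ?_, (h x hx).1⟩
  rcases lt_trichotomy (c.vert x) (c.φ (c.horiz x)) with hlt | heq | hgt
  · exact absurd (frontier_subset_closure hf) ((h x hx).2.2 hlt)
  · exact heq
  · rw [hU.frontier_eq] at hf
    exact absurd ((h x hx).2.1 hgt) hf.2

lemma IsChartOf.mem_iff (h : c.IsChartOf U) (hU : IsOpen U) {x : Space (n + 1)}
    (hx : x ∈ c.nbhd) : x ∈ U ↔ c.φ (c.horiz x) < c.vert x := by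
  refine ⟨fun hf => ?_, (h x hx).2.1⟩
  rcases lt_trichotomy (c.vert x) (c.φ (c.horiz x)) with hlt | heq | hgt
  · exact absurd (subset_closure hf) ((h x hx).2.2 hlt)
  · have := (h x hx).1 heq
    rw [hU.frontier_eq] at this
    exact absurd hf this.2
  · exact hgt

lemma IsChartOf.mem_compl_closure_iff (h : c.IsChartOf U) {x : Space (n + 1)}
    (hx : x ∈ c.nbhd) : x ∈ (closure U)ᶜ ↔ c.vert x < c.φ (c.horiz x) := by
  refine ⟨fun hf => ?_, (h x hx).2.2⟩
  rcases lt_trichotomy (c.vert x) (c.φ (c.horiz x)) with hlt | heq | hgt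
  · exact hlt
  · exact absurd (frontier_subset_closure ((h x hx).1 heq)) hf
  · exact absurd (subset_closure ((h x hx).2.1 hgt)) hf

end GraphChart

lemma LipschitzAtlas.volume_frontier {n : ℕ} {U : Set (Space (n + 1))} (𝒜 : LipschitzAtlas U)
    (hU : IsOpen U) : volume (frontier U) = 0 := by
  have : frontier U ⊆ ⋃ k, {x | (𝒜.chart k).vert x = (𝒜.chart k).φ ((𝒜.chart k).horiz x)} := by
    intro x hx
    obtain ⟨k, hk⟩ := mem_iUnion.1 (𝒜.cover hx)
    exact mem_iUnion.2 ⟨k, ((𝒜.isChart k).mem_frontier_iff hU hk).1 hx⟩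
  refine measure_mono_null this ?_
  exact measure_iUnion_null fun k => (𝒜.chart k).volume_graph

/-! ### Lipschitz functions of compact support and one-dimensional jumps -/

lemma LocallyLipschitz.exists_lipschitzWith_of_hasCompactSupport {E : Type*}
    [NormedAddCommGroup E] [NormedSpace ℝ E] [FiniteDimensional ℝ E] {f : E → ℝ}
    (hf : LocallyLipschitz f) (hs : HasCompactSupport f) : ∃ K, LipschitzWith K f := by
  obtain ⟨R, hR⟩ := hs.isCompact.isBounded.subset_closedBall (0 : E)
  obtain ⟨K, hK⟩ := (hf.locallyLipschitzOn (s := Metric.closedBall (0 : E) (R + 1))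
    ).exists_lipschitzOnWith_of_compact (isCompact_closedBall _ _)
  obtain ⟨M, hM⟩ := hs.exists_bound_of_continuous hf.continuous
  have hz : ∀ y, y ∉ Metric.closedBall (0 : E) R → f y = 0 := fun y hy =>
    image_eq_zero_of_notMem_tsupport fun h => hy (hR h)
  have key : ∀ x y, x ∈ Metric.closedBall (0 : E) R →
      dist (f x) (f y) ≤ max (K : ℝ) M * dist x y := by
    intro x y hx
    have hx' : x ∈ Metric.closedBall (0 : E) (R + 1) :=
      Metric.closedBall_subset_closedBall (by linarith) hx
    by_cases hy : y ∈ Metric.closedBall (0 : E) (R + 1)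
    · exact (hK.dist_le_mul x hx' y hy).trans (by gcongr; exact le_max_left _ _)
    · have hy0 : f y = 0 := hz y fun h => hy (Metric.closedBall_subset_closedBall (by linarith) h)
      -- The enlarged radius `R + 1` keeps the points not covered by the local constant at distance
      -- at least 1, where the sup bound `M` serves as Lipschitz constant.
      have hd : 1 ≤ dist x y := by
        simp only [Metric.mem_closedBall, dist_zero_right, not_le] at hx hy
        rw [dist_comm, dist_eq_norm]
        have := norm_sub_norm_le y x
        linarith
      have hM0 : 0 ≤ M := (norm_nonneg _).trans (hM x)
      calc dist (f x) (f y) = ‖f x‖ := by rw [hy0, dist_zero_right]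
        _ ≤ M * 1 := by simpa using hM x
        _ ≤ max (K : ℝ) M * dist x y := by gcongr; exact le_max_right _ _
  refine ⟨(max (K : ℝ) M).toNNReal, LipschitzWith.of_dist_le_mul fun x y => ?_⟩
  rw [Real.coe_toNNReal (max (K : ℝ) M) (le_max_of_le_left K.2)]
  by_cases hx : x ∈ Metric.closedBall (0 : E) R
  · exact key x y hx
  · by_cases hy : y ∈ Metric.closedBall (0 : E) R
    · rw [dist_comm, dist_comm x]
      exact key y x hy
    · rw [hz x hx, hz y hy, dist_self]
      have : 0 ≤ max (K : ℝ) M := le_max_of_le_left K.2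
      positivity

lemma integral_lineDeriv_eq_zero {E : Type*} [NormedAddCommGroup E] [NormedSpace ℝ E]
    [FiniteDimensional ℝ E] [MeasurableSpace E] [BorelSpace E] {μ : Measure E}
    [μ.IsAddHaarMeasure] {f : E → ℝ} (hf : LocallyLipschitz f) (hs : HasCompactSupport f) (a : E) :
    ∫ x, lineDeriv ℝ f x a ∂μ = 0 := by
  obtain ⟨K, hK⟩ := hf.exists_lipschitzWith_of_hasCompactSupport hs
  -- Integration by parts against the constant 1. It reverses the direction, which is why `-a` is
  -- inserted.
  have h := LipschitzWith.integral_lineDeriv_mul_eq (μ := μ)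
    (LipschitzWith.const (1 : ℝ)) hK hs (-a)
  simpa [lineDeriv] using h.symm

/-- The fundamental theorem of calculus on the line, for a compactly supported function with a jump
at `0`. -/
lemma integral_deriv_of_jump {g g' : ℝ → ℝ} {l r : ℝ} (hd : ∀ t ≠ 0, HasDerivAt g (g' t) t)
    (hi : Integrable g') (hs : HasCompactSupport g) (hl : Tendsto g (𝓝[<] 0) (𝓝 l))
    (hr : Tendsto g (𝓝[>] 0) (𝓝 r)) : ∫ t, g' t = l - r := by
  have hlim := hasCompactSupport_iff_eventuallyEq.1 hs
  rw [Filter.coclosedCompact_eq_cocompact] at hlim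
  -- Nothing is known of `g 0`. Overwriting it by a one-sided limit gives the continuity needed on
  -- that half-line and changes `g` near no other point.
  have hne : ∀ a : ℝ, ∀ t ≠ 0, Function.update g 0 a =ᶠ[𝓝 t] g := fun a t ht =>
    (eventually_ne_nhds ht).mono fun s hs => Function.update_of_ne hs _ _
  have hIoi : ∫ t in Ioi 0, g' t = 0 - r := by
    have := integral_Ioi_of_hasDerivAt_of_tendsto (f := Function.update g 0 r) (f' := g')
      (a := 0) (m := 0) ?_ (fun t ht => (hd t (ne_of_gt ht)).congr_of_eventuallyEq
        (hne r t (ne_of_gt ht))) hi.integrableOn ?_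
    · simpa using this
    · rw [continuousWithinAt_update_same]
      simpa using hr
    · refine tendsto_const_nhds.congr' ?_
      filter_upwards [hlim.filter_mono _root_.atTop_le_cocompact, eventually_gt_atTop 0] with t h h'
      rw [Function.update_of_ne h'.ne', h]
      rfl
  have hIic : ∫ t in Iic 0, g' t = l - 0 := by
    have := integral_Iic_of_hasDerivAt_of_tendsto (f := Function.update g 0 l) (f' := g')
      (a := 0) (m := 0) ?_ (fun t ht => (hd t (ne_of_lt ht)).congr_of_eventuallyEq
        (hne l t (ne_of_lt ht))) hi.integrableOn ?_
    · simpa using this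
    · rw [continuousWithinAt_update_same]
      simpa using hl
    · refine tendsto_const_nhds.congr' ?_
      filter_upwards [hlim.filter_mono _root_.atBot_le_cocompact, eventually_lt_atBot 0] with t h h'
      rw [Function.update_of_ne h'.ne, h]
      rfl
  have := integral_add_compl (measurableSet_Iic (a := (0 : ℝ))) hi
  rw [compl_Iic, hIoi, hIic] at this
  linarith

/-! ### The divergence theorem across a single Lipschitz graph -/

namespace GraphChart

variable {n : ℕ} (c : GraphChart n)

lemma ae_differentiableAt_phi : ∀ᵐ v, DifferentiableAt ℝ c.φ v :=
  c.lipschitz.choose_spec.ae_differentiableAt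

lemma hasFDerivAt_param_fst {v : Space n} (hv : DifferentiableAt ℝ c.φ v) (t : ℝ) :
    HasFDerivAt (fun v => c.param (v, t))
      (c.liftL + (fderiv ℝ c.φ v).smulRight (c.basis (Fin.last n))) v := by
  simp only [param_eq]
  exact c.liftL.hasFDerivAt.add ((hv.hasFDerivAt.add_const t).smul_const _)

lemma hasDerivAt_param_snd (v : Space n) (t : ℝ) :
    HasDerivAt (fun t => c.param (v, t)) (c.basis (Fin.last n)) t := by
  simpa [param] using ((hasDerivAt_id t).smul_const (c.basis (Fin.last n))).const_add (c.graphMap v)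

lemma exists_lipschitzWith_param_fst (t : ℝ) : ∃ K, LipschitzWith K fun v => c.param (v, t) := by
  obtain ⟨K, hK⟩ := c.lipschitz
  simp only [param_eq]
  have h2 := ((ContinuousLinearMap.id ℝ ℝ).smulRight (c.basis (Fin.last n))).lipschitz.comp
    (hK.add (LipschitzWith.const t))
  exact ⟨_, c.liftL.lipschitz.add h2⟩

lemma exists_bound_fderiv_phi : ∃ K : ℝ, ∀ v, ‖fderiv ℝ c.φ v‖ ≤ K := by
  obtain ⟨K, hK⟩ := c.lipschitz
  exact ⟨K, fun v => norm_fderiv_le_of_lipschitz ℝ hK⟩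

/-- The divergence theorem for a function which jumps across a Lipschitz graph: the component `e`
of the (non-normalised) normal of the graph is `Dφ(v)e' - e_d`. -/
theorem integral_fderiv_of_jump {h : Space (n + 1) → ℝ} {C : ℝ} {hl hr : Space n → ℝ}
    (hs : HasCompactSupport h) (hd : ∀ x, c.vert x ≠ c.φ (c.horiz x) → ContDiffAt ℝ 1 h x)
    (hb : ∀ x, c.vert x ≠ c.φ (c.horiz x) → ‖fderiv ℝ h x‖ ≤ C)
    (hhl : ∀ v, Tendsto (fun t => h (c.param (v, t))) (𝓝[<] 0) (𝓝 (hl v)))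
    (hhr : ∀ v, Tendsto (fun t => h (c.param (v, t))) (𝓝[>] 0) (𝓝 (hr v)))
    (e : Space (n + 1)) :
    Integrable (fun x => fderiv ℝ h x e) ∧
    ∫ x, fderiv ℝ h x e =
      ∫ v, (hr v - hl v) * (fderiv ℝ c.φ v (c.horiz e) - c.vert e) := by
  set a := c.horiz e
  set b := c.vert e
  set ed := c.basis (Fin.last n)
  have hC : 0 ≤ C := by
    obtain ⟨x, hx⟩ : ∃ x, c.vert x ≠ c.φ (c.horiz x) := ⟨c.param (0, 1), by simp⟩
    exact (norm_nonneg _).trans (hb x hx)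
  have hne : ∀ᵐ x, c.vert x ≠ c.φ (c.horiz x) := by
    rw [ae_iff]; simpa using c.volume_graph
  have hintK : ∀ w : Space (n + 1), Integrable (fun x => fderiv ℝ h x w) := by
    intro w
    have h1 : IntegrableOn (fun x => fderiv ℝ h x w) (tsupport h) := by
      refine Measure.integrableOn_of_bounded (M := C * ‖w‖) hs.isCompact.measure_lt_top.ne
        (measurable_fderiv_apply_const ℝ h w).aestronglyMeasurable ?_
      refine ae_restrict_of_ae (hne.mono fun x hx => ?_)
      exact (ContinuousLinearMap.le_opNorm _ _).trans (by gcongr; exact hb x hx)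
    refine (integrableOn_iff_integrable_of_support_subset fun x hx => ?_).1 h1
    by_contra hx'
    exact hx (by simp [image_eq_zero_of_notMem_tsupport
      fun h' => hx' (tsupport_fderiv_subset ℝ h')])
  refine ⟨hintK e, ?_⟩
  have hmp := c.measurePreserving_param
  have hme := c.measurableEmbedding_param
  have hintP : ∀ w : Space (n + 1), Integrable (fun p => fderiv ℝ h (c.param p) w)
      (volume.prod volume) := fun w => (hmp.integrable_comp_emb hme).2 (hintK w)
  obtain ⟨K, hK⟩ := c.exists_bound_fderiv_phi
  have hmφ : Measurable fun v => fderiv ℝ c.φ v a - b :=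
    (measurable_fderiv_apply_const ℝ c.φ a).sub_const b
  have hint2 : Integrable (fun p : Space n × ℝ =>
      (fderiv ℝ c.φ p.1 a - b) * fderiv ℝ h (c.param p) ed) (volume.prod volume) := by
    refine (hintP ed).bdd_mul (c := K * ‖a‖ + |b|)
      (hmφ.comp measurable_fst).aestronglyMeasurable (Eventually.of_forall fun p => ?_)
    refine (norm_sub_le _ _).trans ?_
    gcongr
    · exact (ContinuousLinearMap.le_opNorm _ _).trans (by gcongr; exact hK _)
    · exact le_rfl
  -- `L` is the derivative in direction `a` of `h` along a slice `v ↦ param (v, t)`: with `e = liftL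
  -- a + b • ed`, the chain rule adds the slope `Dφ(a)` along `ed` in place of `b`.
  set L : Space n × ℝ → ℝ := fun p => fderiv ℝ h (c.param p) e +
    (fderiv ℝ c.φ p.1 a - b) * fderiv ℝ h (c.param p) ed with hL
  have hintL : Integrable L (volume.prod volume) := (hintP e).add hint2
  have hcs : ∀ t, HasCompactSupport fun v => h (c.param (v, t)) := by
    intro t
    refine HasCompactSupport.intro (hs.isCompact.image c.continuous_horiz) fun v hv => ?_
    refine image_eq_zero_of_notMem_tsupport fun h' => hv ⟨_, h', by simp⟩
  have hcs' : ∀ v, HasCompactSupport fun t => h (c.param (v, t)) := by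
    intro v
    refine HasCompactSupport.intro (hs.isCompact.image
      (f := fun x => c.vert x - c.φ v) (by fun_prop)) fun t ht => ?_
    refine image_eq_zero_of_notMem_tsupport fun h' => ht ⟨_, h', by simp⟩
  have hL0 : ∫ p, L p ∂(volume.prod volume) = 0 := by
    rw [integral_prod_symm _ hintL]
    refine integral_eq_zero_of_ae ?_
    filter_upwards [Measure.ae_ne volume (0 : ℝ)] with t ht
    -- A slice with `t ≠ 0` misses the graph, so `h` is C¹ along it, but φ makes the composition
    -- only Lipschitz. The chain rule is therefore used almost everywhere, by Rademacher's theorem.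
    have hlip : LocallyLipschitz fun v => h (c.param (v, t)) := by
      intro v
      obtain ⟨K₁, s, hs, hs'⟩ := (hd (c.param (v, t)) (by simpa using ht)).exists_lipschitzOnWith
      obtain ⟨K₂, hK₂⟩ := c.exists_lipschitzWith_param_fst t
      exact ⟨K₁ * K₂, _, hK₂.continuous.continuousAt.preimage_mem_nhds hs,
        hs'.comp hK₂.lipschitzOnWith fun v hv => hv⟩
    rw [Pi.zero_apply, ← integral_lineDeriv_eq_zero hlip (hcs t) a (μ := volume)]
    refine integral_congr_ae (c.ae_differentiableAt_phi.mono fun v hv => ?_)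
    have h1 := ((hd (c.param (v, t)) (by simpa using ht)).differentiableAt
      one_ne_zero).hasFDerivAt.comp v (c.hasFDerivAt_param_fst hv t)
    have h2 := h1.hasLineDerivAt a
    refine Eq.trans ?_ h2.lineDeriv.symm
    have he : fderiv ℝ h (c.param (v, t)) e =
        fderiv ℝ h (c.param (v, t)) (c.liftL a) + b * fderiv ℝ h (c.param (v, t)) ed := by
      conv_lhs => rw [c.eq_liftL_add e]
      simp [a, b, ed]
    simp only [hL, he, ContinuousLinearMap.comp_apply, add_apply, map_add,
      ContinuousLinearMap.smulRight_apply, map_smul, smul_eq_mul]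
    ring
  have h3 : ∫ p : Space n × ℝ, (fderiv ℝ c.φ p.1 a - b) * fderiv ℝ h (c.param p) ed
      ∂(volume.prod volume) = ∫ v, (fderiv ℝ c.φ v a - b) * (hl v - hr v) := by
    rw [integral_prod _ hint2]
    refine integral_congr_ae ?_
    -- Integrating first over the vertical fibre turns the derivative along `ed` into the jump.
    filter_upwards [(hintP ed).prod_right_ae] with v hv
    rw [integral_const_mul, integral_deriv_of_jump (fun t ht => ?_) hv (hcs' v) (hhl v) (hhr v)]
    exact ((hd (c.param (v, t)) (by simpa using ht)).differentiableAt
      one_ne_zero).hasFDerivAt.comp_hasDerivAt t (c.hasDerivAt_param_snd v t)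
  have h4 : ∫ x, fderiv ℝ h x e = ∫ p, fderiv ℝ h (c.param p) e ∂(volume.prod volume) :=
    (hmp.integral_comp hme _).symm
  have h5 : ∫ p, L p ∂(volume.prod volume) = ∫ p, fderiv ℝ h (c.param p) e ∂(volume.prod volume) +
      ∫ p : Space n × ℝ, (fderiv ℝ c.φ p.1 a - b) * fderiv ℝ h (c.param p) ed
        ∂(volume.prod volume) := integral_add (hintP e) hint2
  rw [h4]
  rw [hL0, h3] at h5
  rw [eq_neg_of_add_eq_zero_left h5.symm, ← integral_neg]
  congr 1
  funext v
  ring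

end GraphChart

/-! ### One-sided limits at the boundary -/

namespace GraphChart

variable {n : ℕ} (c : GraphChart n)

/-- A function with bounded derivative on one side of a Lipschitz graph extends continuously to the
graph from this side: two points can be joined through the side by a path of comparable length. -/
lemma exists_tendsto_side {E : Type*} [NormedAddCommGroup E] [NormedSpace ℝ E]
    [FiniteDimensional ℝ E] {F : Space (n + 1) → E} {σ C : ℝ} (hσ : σ * σ = 1)
    {O : Set (Space (n + 1))} (hO : O = {y ∈ c.nbhd | 0 < σ * (c.vert y - c.φ (c.horiz y))})
    (hd : ∀ y ∈ O, DifferentiableAt ℝ F y) (hb : ∀ y ∈ O, ‖fderiv ℝ F y‖ ≤ C)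
    {x : Space (n + 1)} (hx : x ∈ c.nbhd) : ∃ G, Tendsto F (𝓝[O] x) (𝓝 G) := by
  rcases O.eq_empty_or_nonempty with hempty | ⟨y₀, hy₀⟩
  · exact ⟨0, by simp [hempty]⟩
  have hC : 0 ≤ C := (norm_nonneg _).trans (hb y₀ hy₀)
  obtain ⟨K, hK⟩ := c.lipschitz
  obtain ⟨r, hr, hball⟩ := Metric.isOpen_iff.1 c.isOpen_nbhd x hx
  set M := ‖c.horizL‖
  have hM : 0 ≤ M := norm_nonneg _
  have hK0 : (0 : ℝ) ≤ K := K.2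
  set e := c.basis (Fin.last n)
  have he : ‖e‖ = 1 := c.basis.orthonormal.1 _
  have hσ1 : |σ| = 1 := by
    rcases mul_self_eq_one_iff.1 hσ with h | h <;> simp [h]
  have hve : c.vert e = 1 := by simp [e, vert]
  have hhe : c.horiz e = 0 := by
    ext j; simp [e, horiz, Fin.castSucc_ne_last]
  have hva : ∀ y z, c.vert (y + z) = c.vert y + c.vert z := c.vertL.map_add
  have hvs : ∀ (a : ℝ) z, c.vert (a • z) = a * c.vert z := c.vertL.map_smul
  have hha : ∀ y z, c.horiz (y + z) = c.horiz y + c.horiz z := c.horizL.map_add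
  have hhs : ∀ (a : ℝ) z, c.horiz (a • z) = a • c.horiz z := c.horizL.map_smul
  -- Points of the δ-ball get lifted by at most `2KMδ`; this δ makes `δ + 2KMδ = r`, so the lifted
  -- points stay in the ball inside the chart.
  set δ := r / (1 + 2 * K * M) with hδ
  have hpos : 0 < 1 + 2 * K * M := by positivity
  have hδ0 : 0 < δ := by positivity
  have hδr : δ + 2 * K * M * δ = r := by rw [hδ]; field_simp
  have seg : ∀ p q, segment ℝ p q ⊆ O → ‖F q - F p‖ ≤ C * ‖q - p‖ := fun p q h =>
    (convex_segment p q).norm_image_sub_le_of_norm_fderiv_le (fun y hy => hd y (h hy))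
      (fun y hy => hb y (h hy)) (left_mem_segment ℝ p q) (right_mem_segment ℝ p q)
  have key : ∀ y ∈ O ∩ Metric.ball x δ, ∀ z ∈ O ∩ Metric.ball x δ,
      ‖F y - F z‖ ≤ C * (1 + 2 * K * M) * ‖y - z‖ := by
    rintro y ⟨hyO, hyb⟩ z ⟨hzO, hzb⟩
    set D := ‖c.horiz y - c.horiz z‖ with hD
    have hDM : D ≤ M * ‖y - z‖ := by
      have := c.horizL.le_opNorm (y - z)
      rwa [map_sub] at this
    -- The path goes from `y` vertically by `s`, straight across, and down to `z`. The height `s`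
    -- bounds the variation of φ between the two horizontal positions.
    set s := K * D with hs
    have hs0 : 0 ≤ s := by positivity
    have hyz : ‖y - z‖ < 2 * δ := by
      rw [← dist_eq_norm]
      have := dist_triangle_right y z x
      rw [Metric.mem_ball] at hyb hzb
      linarith
    have hsδ : s ≤ 2 * K * M * δ := by
      calc s ≤ K * (M * ‖y - z‖) := mul_le_mul_of_nonneg_left hDM hK0
        _ ≤ K * (M * (2 * δ)) := by gcongr
        _ = _ := by ring
    have hup_ball : ∀ p ∈ Metric.ball x δ, p + (σ * s) • e ∈ Metric.ball x r := by
      intro p hp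
      rw [Metric.mem_ball, dist_eq_norm] at hp ⊢
      calc ‖p + (σ * s) • e - x‖ = ‖(p - x) + (σ * s) • e‖ := by congr 1; abel
        _ ≤ ‖p - x‖ + ‖(σ * s) • e‖ := norm_add_le _ _
        _ = ‖p - x‖ + s := by rw [norm_smul, he, norm_mul, Real.norm_eq_abs, hσ1,
              Real.norm_of_nonneg hs0]; ring
        _ < r := by linarith
    have hball_sub : Metric.ball x δ ⊆ Metric.ball x r := Metric.ball_subset_ball (by
      have : 0 ≤ 2 * K * M * δ := by positivity
      linarith)
    have hOpos : ∀ p ∈ O, 0 < σ * (c.vert p - c.φ (c.horiz p)) := fun p hp => by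
      rw [hO] at hp; exact hp.2
    have vertical : ∀ p ∈ O, p ∈ Metric.ball x δ → segment ℝ p (p + (σ * s) • e) ⊆ O := by
      intro p hpO hpb q hq
      have hq1 := (convex_ball x r).segment_subset (hball_sub hpb) (hup_ball p hpb) hq
      rw [segment_eq_image'] at hq
      obtain ⟨τ, hτ, rfl⟩ := hq
      rw [hO]
      refine ⟨hball hq1, ?_⟩
      have h1 := hOpos p hpO
      simp only [add_sub_cancel_left, hva, hvs, hha, hhs, hve, hhe, smul_zero, add_zero, mul_one]
      have : σ * (c.vert p + τ * (σ * s) - c.φ (c.horiz p)) =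
          σ * (c.vert p - c.φ (c.horiz p)) + (σ * σ) * (τ * s) := by ring
      rw [this, hσ]
      have := mul_nonneg hτ.1 hs0
      linarith
    have horizontal : segment ℝ (y + (σ * s) • e) (z + (σ * s) • e) ⊆ O := by
      intro q hq
      have hq1 := (convex_ball x r).segment_subset (hup_ball y hyb) (hup_ball z hzb) hq
      obtain ⟨α, β, hα, hβ, hαβ, rfl⟩ := hq
      rw [hO]
      refine ⟨hball hq1, ?_⟩
      have h1 := hOpos y hyO
      have h2 := hOpos z hzO
      simp only [hva, hvs, hha, hhs, hve, hhe, smul_zero, add_zero, mul_one]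
      set p := α • c.horiz y + β • c.horiz z
      have hpy : |c.φ (c.horiz y) - c.φ p| ≤ s * β := by
        have := hK.dist_le_mul (c.horiz y) p
        rw [Real.dist_eq, dist_eq_norm] at this
        have h : c.horiz y - p = β • (c.horiz y - c.horiz z) := by
          have : α = 1 - β := by linarith
          simp only [p, this]; module
        rw [h, norm_smul, Real.norm_of_nonneg hβ, ← hD] at this
        linarith
      have hpz : |c.φ (c.horiz z) - c.φ p| ≤ s * α := by
        have := hK.dist_le_mul (c.horiz z) p
        rw [Real.dist_eq, dist_eq_norm] at this
        have h : c.horiz z - p = -(α • (c.horiz y - c.horiz z)) := by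
          have : β = 1 - α := by linarith
          simp only [p, this]; module
        rw [h, norm_neg, norm_smul, Real.norm_of_nonneg hα, ← hD] at this
        linarith
      have hpy' : -(s * β) ≤ σ * (c.φ (c.horiz y) - c.φ p) := by
        have := neg_abs_le (σ * (c.φ (c.horiz y) - c.φ p))
        rw [abs_mul, hσ1] at this
        linarith
      have hpz' : -(s * α) ≤ σ * (c.φ (c.horiz z) - c.φ p) := by
        have := neg_abs_le (σ * (c.φ (c.horiz z) - c.φ p))
        rw [abs_mul, hσ1] at this
        linarith
      have hident : σ * (α * (c.vert y + σ * s) + β * (c.vert z + σ * s) - c.φ p) =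
          α * (σ * (c.vert y - c.φ (c.horiz y))) + β * (σ * (c.vert z - c.φ (c.horiz z)))
          + α * (σ * (c.φ (c.horiz y) - c.φ p)) + β * (σ * (c.φ (c.horiz z) - c.φ p))
          + (σ * σ) * s * (α + β) + (α + β - 1) * (σ * c.φ p) := by ring
      rw [hident, hσ, hαβ]
      have e1 := mul_le_mul_of_nonneg_left hpy' hα
      have e2 := mul_le_mul_of_nonneg_left hpz' hβ
      have e3 : 0 < α * (σ * (c.vert y - c.φ (c.horiz y))) +
          β * (σ * (c.vert z - c.φ (c.horiz z))) := by
        rcases hα.eq_or_lt with h | h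
        · have : β = 1 := by linarith
          rw [← h, this]; linarith
        · have := mul_pos h h1
          have := mul_nonneg hβ h2.le
          linarith
      -- At weights `α`, `β` the two Lipschitz errors total at most `2αβs`, which the lift `s`
      -- absorbs.
      have e4 : 2 * (α * β) ≤ 1 := by nlinarith [sq_nonneg (α - β), sq_nonneg (α + β)]
      have e5 : 0 ≤ s * (1 - 2 * (α * β)) := mul_nonneg hs0 (by linarith)
      linarith
    have b1 := seg _ _ (vertical y hyO hyb)
    have b2 := seg _ _ horizontal
    have b3 := seg _ _ (vertical z hzO hzb)
    have hn : ‖(σ * s) • e‖ = s := by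
      rw [norm_smul, he, norm_mul, Real.norm_eq_abs, hσ1, Real.norm_of_nonneg hs0]; ring
    rw [add_sub_cancel_left, hn] at b1 b3
    rw [add_sub_add_right_eq_sub, norm_sub_rev z y] at b2
    have tri : ‖F y - F z‖ ≤ ‖F (y + (σ * s) • e) - F y‖ +
        ‖F (z + (σ * s) • e) - F (y + (σ * s) • e)‖ + ‖F (z + (σ * s) • e) - F z‖ := by
      have : F y - F z = -(F (y + (σ * s) • e) - F y) -
        (F (z + (σ * s) • e) - F (y + (σ * s) • e)) + (F (z + (σ * s) • e) - F z) := by abel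
      rw [this]
      refine (norm_add_le _ _).trans ?_
      gcongr
      refine (norm_sub_le _ _).trans ?_
      rw [norm_neg]
    have hs' : C * s ≤ C * (K * (M * ‖y - z‖)) :=
      mul_le_mul_of_nonneg_left (mul_le_mul_of_nonneg_left hDM hK0) hC
    calc _ ≤ _ := tri
      _ ≤ C * s + C * ‖y - z‖ + C * s := by gcongr
      _ ≤ C * (K * (M * ‖y - z‖)) + C * ‖y - z‖ + C * (K * (M * ‖y - z‖)) := by gcongr
      _ = _ := by ring
  have hlip : LipschitzOnWith (C * (1 + 2 * K * M)).toNNReal F (O ∩ Metric.ball x δ) := by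
    refine LipschitzOnWith.of_dist_le_mul fun y hy z hz => ?_
    rw [dist_eq_norm, dist_eq_norm, Real.coe_toNNReal _ (by positivity)]
    exact key y hy z hz
  -- A globally Lipschitz extension takes at `x` the limit sought.
  obtain ⟨g, hg, hgF⟩ := hlip.extend_finite_dimension
  refine ⟨g x, ?_⟩
  have : 𝓝[O] x = 𝓝[O ∩ Metric.ball x δ] x :=
    (nhdsWithin_inter_of_mem' (mem_nhdsWithin_of_mem_nhds (Metric.ball_mem_nhds x hδ0))).symm
  rw [this]
  refine (hg.continuous.continuousAt.tendsto.mono_left nhdsWithin_le_nhds).congr' ?_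
  filter_upwards [self_mem_nhdsWithin] with y hy using (hgF hy).symm

variable {c} {U : Set (Space (n + 1))}

/-- Vertical lines turn limits from within `U` into limits `t → 0+`; with its mirror image this also
shows that neither side is empty near a boundary point. -/
lemma IsChartOf.tendsto_param_right (h : c.IsChartOf U) {v : Space n} (hv : v ∈ c.box) :
    Tendsto (fun t => c.param (v, t)) (𝓝[>] 0) (𝓝[U] c.graphMap v) := by
  have hcont : Tendsto (fun t => c.param (v, t)) (𝓝[>] 0) (𝓝 (c.graphMap v)) := by
    have : Continuous fun t => c.param (v, t) := by fun_prop
    simpa using (this.tendsto 0).mono_left nhdsWithin_le_nhds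
  refine tendsto_nhdsWithin_iff.2 ⟨hcont, ?_⟩
  filter_upwards [hcont (c.isOpen_nbhd.mem_nhds (graphMap_mem_nbhd c |>.2 hv)),
    self_mem_nhdsWithin] with t ht ht0
  exact (h _ ht).2.1 (by simpa using ht0)

lemma IsChartOf.tendsto_param_left (h : c.IsChartOf U) {v : Space n} (hv : v ∈ c.box) :
    Tendsto (fun t => c.param (v, t)) (𝓝[<] 0) (𝓝[(closure U)ᶜ] c.graphMap v) := by
  have hcont : Tendsto (fun t => c.param (v, t)) (𝓝[<] 0) (𝓝 (c.graphMap v)) := by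
    have : Continuous fun t => c.param (v, t) := by fun_prop
    simpa using (this.tendsto 0).mono_left nhdsWithin_le_nhds
  refine tendsto_nhdsWithin_iff.2 ⟨hcont, ?_⟩
  filter_upwards [hcont (c.isOpen_nbhd.mem_nhds (graphMap_mem_nbhd c |>.2 hv)),
    self_mem_nhdsWithin] with t ht ht0
  exact (h _ ht).2.2 (by simpa using ht0)

lemma IsChartOf.eq_graphMap (h : c.IsChartOf U) (hU : IsOpen U) {x : Space (n + 1)}
    (hx : x ∈ c.nbhd) (hxU : x ∈ frontier U) : x = c.graphMap (c.horiz x) := by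
  have := (h.mem_frontier_iff hU hx).1 hxU
  conv_lhs => rw [← c.param_horiz_vert x, this, sub_self, param_zero]

end GraphChart

section Limits

variable {n : ℕ} {U : Set (Space (n + 1))}

lemma LipschitzAtlas.neBot_nhdsWithin (𝒜 : LipschitzAtlas U) (hU : IsOpen U) {x : Space (n + 1)}
    (hx : x ∈ frontier U) : (𝓝[U] x).NeBot ∧ (𝓝[(closure U)ᶜ] x).NeBot := by
  obtain ⟨k, hk⟩ := mem_iUnion.1 (𝒜.cover hx)
  rw [(𝒜.isChart k).eq_graphMap hU hk hx]
  exact ⟨((𝒜.isChart k).tendsto_param_right hk.1).neBot,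
    ((𝒜.isChart k).tendsto_param_left hk.1).neBot⟩

/-- `exists_tendsto_side` applies to `fderiv ℝ f`, whose derivative is bounded by hypothesis; the
sign `σ = ±1` selects the side, and the Riesz isometry turns the limit into one of gradients. -/
lemma LipschitzAtlas.exists_tendsto_gradient (𝒜 : LipschitzAtlas U) (hU : IsOpen U)
    {f : Space (n + 1) → ℝ} (hf : IsBoundedC2On f (frontier U)ᶜ) {x : Space (n + 1)}
    (hx : x ∈ frontier U) :
    (∃ G, Tendsto (gradient f) (𝓝[U] x) (𝓝 G)) ∧
    ∃ G, Tendsto (gradient f) (𝓝[(closure U)ᶜ] x) (𝓝 G) := by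
  obtain ⟨k, hk⟩ := mem_iUnion.1 (𝒜.cover hx)
  set c := 𝒜.chart k
  have hc : c.IsChartOf U := 𝒜.isChart k
  obtain ⟨C, hC⟩ := hf.2 2 le_rfl
  have hopen : IsOpen (frontier U)ᶜ := isClosed_frontier.isOpen_compl
  have hd : ∀ y ∈ (frontier U)ᶜ, DifferentiableAt ℝ (fderiv ℝ f) y := fun y hy =>
    ((hf.1.contDiffAt (hopen.mem_nhds hy)).fderiv_right (m := 1) (by norm_num)).differentiableAt
      one_ne_zero
  have hb : ∀ y ∈ (frontier U)ᶜ, ‖fderiv ℝ (fderiv ℝ f) y‖ ≤ C := fun y hy => by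
    rw [← norm_iteratedFDeriv_one, norm_iteratedFDeriv_fderiv]
    exact hC y hy
  have side : ∀ (V : Set (Space (n + 1))) (σ : ℝ), σ * σ = 1 →
      (∀ y ∈ c.nbhd, y ∈ V ↔ 0 < σ * (c.vert y - c.φ (c.horiz y))) →
      ∃ G, Tendsto (gradient f) (𝓝[V] x) (𝓝 G) := by
    intro V σ hσ hV
    have hsub : {y ∈ c.nbhd | 0 < σ * (c.vert y - c.φ (c.horiz y))} ⊆ (frontier U)ᶜ := by
      intro y hy hyU
      have := (hc.mem_frontier_iff hU hy.1).1 hyU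
      simp [this] at hy
    obtain ⟨G, hG⟩ := c.exists_tendsto_side hσ rfl (fun y hy => hd y (hsub hy))
      (fun y hy => hb y (hsub hy)) hk
    refine ⟨(InnerProductSpace.toDual ℝ (Space (n + 1))).symm G, ?_⟩
    have hle : 𝓝[V] x ≤ 𝓝[{y ∈ c.nbhd | 0 < σ * (c.vert y - c.φ (c.horiz y))}] x := by
      rw [← nhdsWithin_inter_of_mem' (t := c.nbhd)
        (mem_nhdsWithin_of_mem_nhds (c.isOpen_nbhd.mem_nhds hk))]
      exact nhdsWithin_mono _ fun y hy => ⟨hy.2, (hV y hy.2).1 hy.1⟩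
    exact ((InnerProductSpace.toDual ℝ (Space (n + 1))).symm.continuous.tendsto G).comp
      (hG.mono_left hle)
  refine ⟨side U 1 (by norm_num) fun y hy => ?_, side _ (-1) (by norm_num) fun y hy => ?_⟩
  · rw [hc.mem_iff hU hy]; simp
  · rw [hc.mem_compl_closure_iff hy]; simp

lemma LipschitzAtlas.tendsto_gradientFrom (𝒜 : LipschitzAtlas U) (hU : IsOpen U)
    {f : Space (n + 1) → ℝ} (hf : IsBoundedC2On f (frontier U)ᶜ) {x : Space (n + 1)}
    (hx : x ∈ frontier U) :
    Tendsto (gradient f) (𝓝[U] x) (𝓝 (gradientFrom U f x)) ∧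
    Tendsto (gradient f) (𝓝[(closure U)ᶜ] x) (𝓝 (gradientFrom (closure U)ᶜ f x)) :=
  ⟨tendsto_nhds_limUnder (𝒜.exists_tendsto_gradient hU hf hx).1,
    tendsto_nhds_limUnder (𝒜.exists_tendsto_gradient hU hf hx).2⟩

end Limits

/-! ### The outer unit normal -/

namespace GraphChart

variable {n : ℕ} (c : GraphChart n)

lemma norm_sq_eq (x : Space (n + 1)) : ‖x‖ ^ 2 = ‖c.horiz x‖ ^ 2 + c.vert x ^ 2 := by
  rw [← c.basis.repr.norm_map x, EuclideanSpace.norm_sq_eq, EuclideanSpace.norm_sq_eq,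
    Fin.sum_univ_castSucc]
  simp [horiz, vert]

lemma surfaceElement_pos (v : Space n) : 0 < c.surfaceElement v :=
  Real.sqrt_pos.2 (by positivity)

lemma normal_eq (v : Space n) : c.normal v = (c.surfaceElement v)⁻¹ •
    (c.liftL (gradient c.φ v) + (-1 : ℝ) • c.basis (Fin.last n)) := by
  simp [normal, liftL_apply, sub_eq_add_neg]

lemma norm_normal (v : Space n) : ‖c.normal v‖ = 1 := by
  have h : ‖c.liftL (gradient c.φ v) + (-1 : ℝ) • c.basis (Fin.last n)‖ = c.surfaceElement v := by
    rw [surfaceElement, ← Real.sqrt_sq (norm_nonneg (_ + _)), c.norm_sq_eq, horiz_liftL_add,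
      vert_liftL_add]
    congr 1
    ring
  rw [normal_eq, norm_smul, h, norm_inv, Real.norm_of_nonneg (c.surfaceElement_pos v).le,
    inv_mul_cancel₀ (c.surfaceElement_pos v).ne']

lemma inner_liftL (w : Space (n + 1)) (g : Space n) :
    inner ℝ w (c.liftL g) = inner ℝ (c.horiz w) g := by
  rw [liftL_apply, inner_sum, PiLp.inner_apply]
  refine Finset.sum_congr rfl fun j _ => ?_
  rw [inner_smul_right, real_inner_comm, ← c.basis.repr_apply_apply]
  simp [horiz]

/-- The surface element cancels the normalisation of the normal. This identifies the weight in
`integral_fderiv_of_jump` with the surface density times a normal component. -/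
lemma inner_normal (w : Space (n + 1)) (v : Space n) :
    c.surfaceElement v * inner ℝ w (c.normal v) =
      fderiv ℝ c.φ v (c.horiz w) - c.vert w := by
  have h := (c.surfaceElement_pos v).ne'
  rw [normal_eq, inner_smul_right, mul_inv_cancel_left₀ h, inner_add_right, inner_smul_right,
    inner_liftL, real_inner_comm, inner_gradient_left, real_inner_comm, ← c.basis.repr_apply_apply]
  simp [vert, sub_eq_add_neg]

/-- The signed height above the graph vanishes at `x` and has positive derivative along the ray in
direction `w`. -/
lemma vert_sub_eventually_pos {x w : Space (n + 1)} (hx : c.vert x = c.φ (c.horiz x))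
    (hd : DifferentiableAt ℝ c.φ (c.horiz x)) {σ : ℝ}
    (hw : 0 < σ * (c.vert w - fderiv ℝ c.φ (c.horiz x) (c.horiz w))) :
    ∀ᶠ t : ℝ in 𝓝[>] 0, 0 < σ * (c.vert (x + t • w) - c.φ (c.horiz (x + t • w))) := by
  have hline : HasDerivAt (fun t : ℝ => x + t • w) w 0 := by
    simpa using ((hasDerivAt_id (0 : ℝ)).smul_const w).const_add x
  have h1 : HasDerivAt (fun t : ℝ => c.vert (x + t • w)) (c.vert w) 0 :=
    c.vertL.hasFDerivAt.comp_hasDerivAt 0 hline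
  have h2 : HasDerivAt (fun t : ℝ => c.horiz (x + t • w)) (c.horiz w) 0 :=
    c.horizL.hasFDerivAt.comp_hasDerivAt 0 hline
  have h3 : HasFDerivAt c.φ (fderiv ℝ c.φ (c.horiz x)) (c.horiz (x + (0 : ℝ) • w)) := by
    simpa using hd.hasFDerivAt
  have h4 := (h1.sub (h3.comp_hasDerivAt 0 h2)).const_mul σ
  have h5 := h4.tendsto_slope_zero_right
  filter_upwards [h5.eventually_const_lt hw, self_mem_nhdsWithin] with t ht ht0
  simp only [Function.comp_apply, Pi.sub_apply, zero_add, zero_smul, add_zero, hx, sub_self,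
    mul_zero, sub_zero, smul_eq_mul] at ht
  exact (pos_iff_pos_of_mul_pos ht).1 (inv_pos.2 ht0)

end GraphChart

section OuterNormal

variable {n : ℕ} {U : Set (Space (n + 1))}

lemma IsOuterNormalAt.norm_eq {x ν : Space (n + 1)} (h : IsOuterNormalAt U x ν) : ‖ν‖ = 1 := by
  obtain ⟨c, _, _, _, _, rfl⟩ := h
  exact c.norm_normal _

/-- A chart-free property of the normal, strong enough to determine it among unit vectors. -/
lemma IsOuterNormalAt.eventually_mem (hU : IsOpen U) {x ν : Space (n + 1)}
    (h : IsOuterNormalAt U x ν) (w : Space (n + 1)) :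
    (inner ℝ w ν < 0 → ∀ᶠ t : ℝ in 𝓝[>] 0, x + t • w ∈ U) ∧
    (0 < inner ℝ w ν → ∀ᶠ t : ℝ in 𝓝[>] 0, x + t • w ∈ (closure U)ᶜ) := by
  obtain ⟨c, hc, hxU, hx, hd, rfl⟩ := h
  have hx0 := (hc.mem_frontier_iff hU hx).1 hxU
  have hpos := c.surfaceElement_pos (c.horiz x)
  have hin := c.inner_normal w (c.horiz x)
  have hnb : ∀ᶠ t : ℝ in 𝓝[>] 0, x + t • w ∈ c.nbhd := by
    have : Tendsto (fun t : ℝ => x + t • w) (𝓝[>] 0) (𝓝 x) := by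
      have : Continuous fun t : ℝ => x + t • w := by fun_prop
      simpa using (this.tendsto 0).mono_left nhdsWithin_le_nhds
    exact this (c.isOpen_nbhd.mem_nhds hx)
  refine ⟨fun hw => ?_, fun hw => ?_⟩
  · have := mul_neg_of_pos_of_neg hpos hw
    filter_upwards [hnb, c.vert_sub_eventually_pos hx0 hd (σ := 1) (w := w) (by linarith)]
      with t h1 h2
    exact (hc _ h1).2.1 (by linarith)
  · have := mul_pos hpos hw
    filter_upwards [hnb, c.vert_sub_eventually_pos hx0 hd (σ := -1) (w := w) (by linarith)]
      with t h1 h2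
    exact (hc _ h1).2.2 (by linarith)

lemma IsOuterNormalAt.unique (hU : IsOpen U) {x ν ν' : Space (n + 1)}
    (h : IsOuterNormalAt U x ν) (h' : IsOuterNormalAt U x ν') : ν = ν' := by
  by_contra hne
  have hlt : inner ℝ ν' ν < 1 :=
    (inner_lt_one_iff_real_of_norm_eq_one h'.norm_eq h.norm_eq).2 (Ne.symm hne)
  -- For distinct unit vectors, `ν' - ν` points inwards with respect to `ν` and outwards with
  -- respect to `ν'`; its ray would be in both sides at once.
  have h1 := (h.eventually_mem hU (ν' - ν)).1 (by
    rw [inner_sub_left, real_inner_self_eq_norm_sq, h.norm_eq]; linarith)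
  have h2 := (h'.eventually_mem hU (ν' - ν)).2 (by
    rw [inner_sub_left, real_inner_self_eq_norm_sq, h'.norm_eq, real_inner_comm]; linarith)
  obtain ⟨t, ht1, ht2⟩ := (h1.and h2).exists
  exact ht2 (subset_closure ht1)

lemma norm_outerNormal_le (x : Space (n + 1)) : ‖outerNormal U x‖ ≤ 1 := by
  unfold outerNormal
  split_ifs with h
  · exact (h.choose_spec.norm_eq).le
  · simp

lemma GraphChart.IsChartOf.outerNormal_graphMap {c : GraphChart n} (hc : c.IsChartOf U)
    (hU : IsOpen U) {v : Space n} (hv : v ∈ c.box) (hd : DifferentiableAt ℝ c.φ v) :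
    outerNormal U (c.graphMap v) = c.normal v := by
  have hmem : c.graphMap v ∈ c.nbhd := c.graphMap_mem_nbhd.2 hv
  have h : IsOuterNormalAt U (c.graphMap v) (c.normal v) :=
    ⟨c, hc, (hc.mem_frontier_iff hU hmem).2 (by simp), hmem, by simpa using hd, by simp⟩
  have hex : ∃ ν, IsOuterNormalAt U (c.graphMap v) ν := ⟨_, h⟩
  rw [outerNormal, dif_pos hex]
  exact hex.choose_spec.unique hU h

end OuterNormal

/-! ### The divergence theorem on a Lipschitz domain -/

section DivergenceTheorem

variable {n : ℕ} {U : Set (Space (n + 1))}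

/-- `q` is continuously differentiable off `∂U`, with bounded derivative, and has the boundary
values `qi` from within `U` and `qe` from within the complement of the closure of `U`. -/
structure IsPiecewiseC1 (U : Set (Space (n + 1))) (q qi qe : Space (n + 1) → ℝ) : Prop where
  contDiffAt : ∀ x ∉ frontier U, ContDiffAt ℝ 1 q x
  bound : ∃ C, ∀ x ∉ frontier U, ‖q x‖ ≤ C
  bound_fderiv : ∃ C, ∀ x ∉ frontier U, ‖fderiv ℝ q x‖ ≤ C
  tendsto_int : ∀ x ∈ frontier U, Tendsto q (𝓝[U] x) (𝓝 (qi x))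
  tendsto_ext : ∀ x ∈ frontier U, Tendsto q (𝓝[(closure U)ᶜ] x) (𝓝 (qe x))

lemma ContDiff.exists_bound_fderiv {d : ℕ} {g : Space d → ℝ} (hg : ContDiff ℝ 1 g)
    (hs : HasCompactSupport g) : ∃ C, ∀ x, ‖fderiv ℝ g x‖ ≤ C :=
  (hs.fderiv (𝕜 := ℝ)).exists_bound_of_continuous (hg.continuous_fderiv one_ne_zero)

lemma ContDiff.integral_fderiv_eq_zero {d : ℕ} {h : Space d → ℝ} (hh : ContDiff ℝ 1 h)
    (hs : HasCompactSupport h) (e : Space d) :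
    Integrable (fun x => fderiv ℝ h x e) ∧ ∫ x, fderiv ℝ h x e = 0 := by
  constructor
  · have hc : Continuous fun x => fderiv ℝ h x e :=
      (hh.continuous_fderiv one_ne_zero).clm_apply continuous_const
    exact hc.integrable_of_hasCompactSupport (hs.fderiv_apply (𝕜 := ℝ) e)
  · rw [← integral_lineDeriv_eq_zero (μ := volume) hh.locallyLipschitz hs e]
    exact integral_congr_ae (Eventually.of_forall fun x =>
      ((hh.differentiable one_ne_zero).differentiableAt.lineDeriv_eq_fderiv).symm)

namespace IsPiecewiseC1

variable {q qi qe g : Space (n + 1) → ℝ}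

lemma contDiffAt_mul (hq : IsPiecewiseC1 U q qi qe) (hg : ContDiff ℝ 1 g) {x : Space (n + 1)}
    (hx : x ∉ frontier U ∨ x ∉ tsupport g) : ContDiffAt ℝ 1 (fun x => g x * q x) x := by
  rcases hx with hx | hx
  · exact hg.contDiffAt.mul (hq.contDiffAt x hx)
  · refine (contDiffAt_const (c := (0 : ℝ))).congr_of_eventuallyEq ?_
    filter_upwards [notMem_tsupport_iff_eventuallyEq.1 hx] with y hy
    simp [hy]

lemma exists_bound_fderiv_mul (hq : IsPiecewiseC1 U q qi qe) (hg : ContDiff ℝ 1 g)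
    (hs : HasCompactSupport g) :
    ∃ C, ∀ x, (x ∉ frontier U ∨ x ∉ tsupport g) → ‖fderiv ℝ (fun x => g x * q x) x‖ ≤ C := by
  obtain ⟨C₁, h₁⟩ := hq.bound
  obtain ⟨C₂, h₂⟩ := hq.bound_fderiv
  obtain ⟨C₃, h₃⟩ := hs.exists_bound_of_continuous hg.continuous
  obtain ⟨C₄, h₄⟩ := hg.exists_bound_fderiv hs
  refine ⟨max 0 (C₃ * C₂ + C₁ * C₄), fun x hx => ?_⟩
  by_cases hx' : x ∉ tsupport g
  · have : fderiv ℝ (fun x => g x * q x) x = 0 := by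
      have h : (fun x => g x * q x) =ᶠ[𝓝 x] fun _ => 0 := by
        filter_upwards [notMem_tsupport_iff_eventuallyEq.1 hx'] with y hy
        simp [hy]
      rw [h.fderiv_eq]
      simp
    simp [this]
  · have hxU : x ∉ frontier U := hx.resolve_right hx'
    refine le_max_of_le_right ?_
    rw [fderiv_fun_mul (hg.differentiable one_ne_zero x)
      ((hq.contDiffAt x hxU).differentiableAt one_ne_zero)]
    refine (norm_add_le _ _).trans ?_
    rw [norm_smul, norm_smul]
    have := (norm_nonneg _).trans (h₁ x hxU)
    have := (norm_nonneg _).trans (h₃ x)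
    gcongr
    exacts [h₃ x, h₂ x hxU, h₁ x hxU, h₄ x]

/-- The divergence theorem for test functions supported in a chart. -/
lemma integral_chart (hU : IsOpen U) (hq : IsPiecewiseC1 U q qi qe) (hg : ContDiff ℝ 1 g)
    (hs : HasCompactSupport g) {c : GraphChart n} (hc : c.IsChartOf U) (hgc : tsupport g ⊆ c.nbhd)
    (e : Space (n + 1)) :
    Integrable (fun x => fderiv ℝ (fun x => g x * q x) x e) ∧
    ∫ x, fderiv ℝ (fun x => g x * q x) x e = ∫ v in c.box, g (c.graphMap v) *
      (qi (c.graphMap v) - qe (c.graphMap v)) * (fderiv ℝ c.φ v (c.horiz e) - c.vert e) := by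
  obtain ⟨C, hC⟩ := hq.exists_bound_fderiv_mul hg hs
  -- Outside the chart the graph of φ has no relation to `∂U`, but there `g` vanishes.
  have hoff : ∀ x, c.vert x ≠ c.φ (c.horiz x) → x ∉ frontier U ∨ x ∉ tsupport g := by
    intro x hx
    by_contra! h
    exact hx ((hc.mem_frontier_iff hU (hgc h.2)).1 h.1)
  have hzero : ∀ v ∉ c.box, ∀ t, g (c.param (v, t)) = 0 := fun v hv t =>
    image_eq_zero_of_notMem_tsupport fun h => hv (by simpa using (hgc h).1)
  have hzero' : ∀ v ∉ c.box, g (c.graphMap v) = 0 := fun v hv => by simpa using hzero v hv 0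
  have hgt : ∀ v, Tendsto (fun t => g (c.param (v, t))) (𝓝 0) (𝓝 (g (c.graphMap v))) := by
    intro v
    have : Continuous fun t => g (c.param (v, t)) := hg.continuous.comp (by fun_prop)
    simpa using this.tendsto 0
  have hmem : ∀ v ∈ c.box, c.graphMap v ∈ frontier U := fun v hv =>
    (hc.mem_frontier_iff hU (c.graphMap_mem_nbhd.2 hv)).2 (by simp)
  have := c.integral_fderiv_of_jump (h := fun x => g x * q x)
    (hl := fun v => g (c.graphMap v) * qe (c.graphMap v))
    (hr := fun v => g (c.graphMap v) * qi (c.graphMap v)) hs.mul_right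
    (fun x hx => hq.contDiffAt_mul hg (hoff x hx)) (fun x hx => hC x (hoff x hx))
    (fun v => ?_) (fun v => ?_) e
  · refine ⟨this.1, this.2.trans ?_⟩
    rw [setIntegral_eq_integral_of_forall_compl_eq_zero (fun v hv => by simp [hzero' v hv])]
    congr 1
    funext v
    ring
  · by_cases hv : v ∈ c.box
    · exact ((hgt v).mono_left nhdsWithin_le_nhds).mul
        ((hq.tendsto_ext _ (hmem v hv)).comp (hc.tendsto_param_left hv))
    · simp [hzero v hv, hzero' v hv]
  · by_cases hv : v ∈ c.box
    · exact ((hgt v).mono_left nhdsWithin_le_nhds).mul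
        ((hq.tendsto_int _ (hmem v hv)).comp (hc.tendsto_param_right hv))
    · simp [hzero v hv, hzero' v hv]

/-- The divergence theorem for a function which jumps across `∂U`. -/
theorem integral_fderiv_mul (hU : IsOpen U) (𝒜 : LipschitzAtlas U)
    (η : SmoothPartitionOfUnity (Fin 𝒜.size) 𝓘(ℝ, Space (n + 1)) (Space (n + 1)) (frontier U))
    (hη : η.IsSubordinate fun k => (𝒜.chart k).nbhd)
    (hq : IsPiecewiseC1 U q qi qe) (hg : ContDiff ℝ 1 g) (hs : HasCompactSupport g)
    (e : Space (n + 1)) :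
    Integrable (fun x => fderiv ℝ (fun x => g x * q x) x e) ∧
    ∫ x, fderiv ℝ (fun x => g x * q x) x e = ∑ k, ∫ v in (𝒜.chart k).box,
      η k ((𝒜.chart k).graphMap v) * g ((𝒜.chart k).graphMap v) *
      (qi ((𝒜.chart k).graphMap v) - qe ((𝒜.chart k).graphMap v)) *
      (fderiv ℝ (𝒜.chart k).φ v ((𝒜.chart k).horiz e) - (𝒜.chart k).vert e) := by
  -- The `η k` sum to one only on `∂U`. A second partition of unity, subordinate to the charts and
  -- to `(frontier U)ᶜ`, splits the remainder `(1 - ∑ η k) g`.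
  let V : Option (Fin 𝒜.size) → Set (Space (n + 1)) := fun o =>
    o.elim (frontier U)ᶜ fun k => (𝒜.chart k).nbhd
  obtain ⟨θ, hθ⟩ := SmoothPartitionOfUnity.exists_isSubordinate 𝓘(ℝ, Space (n + 1))
    (isClosed_univ (X := Space (n + 1))) V
    (fun o => by
      cases o with
      | none => exact isClosed_frontier.isOpen_compl
      | some k => exact (𝒜.chart k).isOpen_nbhd)
    (fun x _ => by
      by_cases hx : x ∈ frontier U
      · obtain ⟨k, hk⟩ := mem_iUnion.1 (𝒜.cover hx)
        exact mem_iUnion.2 ⟨some k, hk⟩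
      · exact mem_iUnion.2 ⟨none, hx⟩)
  have hθ1 : ∀ x, ∑ o, θ o x = 1 := fun x => by
    rw [← finsum_eq_sum_of_fintype]; exact θ.sum_eq_one (mem_univ x)
  have hη1 : ∀ x ∈ frontier U, ∑ k, η k x = 1 := fun x hx => by
    rw [← finsum_eq_sum_of_fintype]; exact η.sum_eq_one hx
  have hηc : ∀ k, ContDiff ℝ 1 (η k) := fun k =>
    ((η k).contMDiff.contDiff).of_le (by exact_mod_cast le_top)
  have hθc : ∀ o, ContDiff ℝ 1 (θ o) := fun o =>
    ((θ o).contMDiff.contDiff).of_le (by exact_mod_cast le_top)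
  have hη0c : ContDiff ℝ 1 fun x => 1 - ∑ k, η k x :=
    contDiff_const.sub (ContDiff.sum fun k _ => hηc k)
  let G : Fin 𝒜.size ⊕ Option (Fin 𝒜.size) → Space (n + 1) → ℝ := fun i =>
    i.elim (fun k x => η k x * g x) fun o x => θ o x * ((1 - ∑ k, η k x) * g x)
  have hGc : ∀ i, ContDiff ℝ 1 (G i) := by
    rintro (k | o)
    · exact (hηc k).mul hg
    · exact (hθc o).mul (hη0c.mul hg)
  have hGs : ∀ i, HasCompactSupport (G i) := by
    rintro (k | o)
    · exact hs.mul_left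
    · exact HasCompactSupport.mul_left (HasCompactSupport.mul_left hs)
  have hsum : ∀ x, g x = ∑ i, G i x := by
    intro x
    rw [Fintype.sum_sum_type]
    simp only [G, Sum.elim_inl, Sum.elim_inr]
    rw [← Finset.sum_mul, ← Finset.sum_mul, hθ1]
    ring
  have hinl : ∀ k, _ := fun k => hq.integral_chart hU (hGc (Sum.inl k)) (hGs (Sum.inl k))
    (𝒜.isChart k) ((tsupport_mul_subset_left).trans (hη k)) e
  have hinr : ∀ o, Integrable (fun x => fderiv ℝ (fun x => G (Sum.inr o) x * q x) x e) ∧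
      ∫ x, fderiv ℝ (fun x => G (Sum.inr o) x * q x) x e = 0 := by
    intro o
    cases o with
    | none =>
      have hsub : tsupport (G (Sum.inr none)) ⊆ (frontier U)ᶜ :=
        (tsupport_mul_subset_left).trans (hθ none)
      refine ContDiff.integral_fderiv_eq_zero (contDiff_iff_contDiffAt.2 fun x =>
        hq.contDiffAt_mul (hGc _) ?_) (hGs _).mul_right e
      by_contra! h
      exact hsub h.2 h.1
    | some k =>
      have h := hq.integral_chart hU (hGc (Sum.inr (some k))) (hGs (Sum.inr (some k)))
        (𝒜.isChart k) ((tsupport_mul_subset_left).trans (hθ (some k))) e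
      refine ⟨h.1, h.2.trans ?_⟩
      -- The remainder has a zero factor on `∂U`, so it contributes no boundary term even inside a
      -- chart.
      refine setIntegral_eq_zero_of_forall_eq_zero fun v hv => ?_
      have hmem : (𝒜.chart k).graphMap v ∈ frontier U :=
        ((𝒜.isChart k).mem_frontier_iff hU ((𝒜.chart k).graphMap_mem_nbhd.2 hv)).2 (by simp)
      simp [G, hη1 _ hmem]
  have hint : ∀ i, Integrable (fun x => fderiv ℝ (fun x => G i x * q x) x e) := by
    rintro (k | o)
    · exact (hinl k).1
    · exact (hinr o).1
  have hae : (fun x => fderiv ℝ (fun x => g x * q x) x e) =ᵐ[volume]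
      fun x => ∑ i, fderiv ℝ (fun x => G i x * q x) x e := by
    have hnull : ∀ᵐ x, x ∉ frontier U := by
      simpa [ae_iff] using 𝒜.volume_frontier hU
    filter_upwards [hnull] with x hx
    have : (fun x => g x * q x) = fun x => ∑ i, G i x * q x := by
      funext y
      rw [hsum y, Finset.sum_mul]
    rw [this, fderiv_fun_sum fun i _ =>
      (hq.contDiffAt_mul (hGc i) (Or.inl hx)).differentiableAt one_ne_zero,
      sum_apply]
  refine ⟨(integrable_finsetSum _ fun i _ => hint i).congr hae.symm, ?_⟩
  rw [integral_congr_ae hae, integral_finsetSum _ fun i _ => hint i, Fintype.sum_sum_type]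
  simp only [(hinr _).2, Finset.sum_const_zero, add_zero]
  exact Finset.sum_congr rfl fun k _ => (hinl k).2

end IsPiecewiseC1

end DivergenceTheorem

/-! ### Mollification of a function with bounded weak gradient -/

section Mollification

variable {E : Type*} [NormedAddCommGroup E]

/-- Dominated convergence in `L²`, for functions supported in a common compact set. -/
lemma tendsto_eLpNorm_sub_of_bounded {X : Type*} [TopologicalSpace X] [MeasurableSpace X]
    [OpensMeasurableSpace X] [T2Space X]
    {μ : Measure X} [IsFiniteMeasureOnCompacts μ] {F : ℕ → X → E} {G : X → E} {K : Set X} {C : ℝ}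
    (hK : IsCompact K) (hF : ∀ k, AEStronglyMeasurable (F k) μ) (hG : AEStronglyMeasurable G μ)
    (hFK : ∀ k, ∀ x ∉ K, F k x = 0) (hGK : ∀ x ∉ K, G x = 0) (hFC : ∀ k, ∀ᵐ x ∂μ, ‖F k x‖ ≤ C)
    (hGC : ∀ᵐ x ∂μ, ‖G x‖ ≤ C) (hlim : ∀ᵐ x ∂μ, Tendsto (fun k => F k x) atTop (𝓝 (G x))) :
    Tendsto (fun k => eLpNorm (F k - G) 2 μ) atTop (𝓝 0) := by
  have h : Tendsto (fun k => ∫⁻ x, ‖(F k - G) x‖ₑ ^ (2 : ℝ) ∂μ) atTop (𝓝 (∫⁻ _, 0 ∂μ)) := by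
    refine tendsto_lintegral_of_dominated_convergence'
      (K.indicator fun _ => ENNReal.ofReal (C + C) ^ (2 : ℝ))
      (fun k => (((hF k).sub hG).enorm).pow_const 2) (fun k => ?_) ?_ ?_
    · filter_upwards [hFC k, hGC] with x h1 h2
      by_cases hx : x ∈ K
      · rw [indicator_of_mem hx]
        refine ENNReal.rpow_le_rpow ?_ (by norm_num)
        rw [← ofReal_norm]
        refine ENNReal.ofReal_le_ofReal ?_
        exact (norm_sub_le _ _).trans (add_le_add h1 h2)
      · simp [hFK k x hx, hGK x hx, indicator_of_notMem hx]
    · rw [lintegral_indicator hK.measurableSet, lintegral_const]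
      refine ENNReal.mul_ne_top (by finiteness) ?_
      simpa using hK.measure_lt_top.ne
    · filter_upwards [hlim] with x hx
      have h1 : Tendsto (fun k => ‖F k x - G x‖ₑ) atTop (𝓝 0) := by
        have := (hx.sub_const (G x)).enorm
        simpa using this
      simpa using h1.ennrpow_const 2
  have h2 := h.ennrpow_const (1 / 2)
  simp only [lintegral_zero] at h2
  rw [ENNReal.zero_rpow_of_pos (by norm_num)] at h2
  refine h2.congr fun k => ?_
  rw [eLpNorm_eq_lintegral_rpow_enorm_toReal (by norm_num) (by norm_num)]
  norm_num

variable {d : ℕ} [NormedSpace ℝ E]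

open Convolution

lemma ContDiffBump.convolution_apply (b : ContDiffBump (0 : Space d)) (g : Space d → E)
    (x : Space d) : (b.normed volume ⋆[ContinuousLinearMap.lsmul ℝ ℝ, volume] g) x =
      ∫ t, b.normed volume t • g (x - t) := rfl

lemma ContDiffBump.norm_convolution_le (b : ContDiffBump (0 : Space d)) {g : Space d → E} {C : ℝ}
    (hg : ∀ x, ‖g x‖ ≤ C) (x : Space d) :
    ‖(b.normed volume ⋆[ContinuousLinearMap.lsmul ℝ ℝ, volume] g) x‖ ≤ C := by
  rw [b.convolution_apply]
  have h := norm_integral_le_of_norm_le (μ := volume) (f := fun t => b.normed volume t • g (x - t))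
    (g := fun t => b.normed volume t * C) (b.integrable_normed.mul_const C)
    (Eventually.of_forall fun t => by
      rw [norm_smul, Real.norm_of_nonneg (b.nonneg_normed t)]
      exact mul_le_mul_of_nonneg_left (hg _) (b.nonneg_normed t))
  rwa [integral_mul_const, b.integral_normed, one_mul] at h

lemma ContDiffBump.convolution_eq_zero (b : ContDiffBump (0 : Space d)) (hb : b.rOut ≤ 1)
    {g : Space d → E} {T : Set (Space d)} (hg : ∀ x ∉ T, g x = 0) {x : Space d}
    (hx : x ∉ Metric.cthickening 1 T) :
    (b.normed volume ⋆[ContinuousLinearMap.lsmul ℝ ℝ, volume] g) x = 0 := by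
  rw [b.convolution_apply]
  refine integral_eq_zero_of_ae (Eventually.of_forall fun t => ?_)
  by_cases ht : t ∈ Metric.ball (0 : Space d) b.rOut
  · have : x - t ∉ T := by
      intro h
      refine hx (Metric.mem_cthickening_of_dist_le x (x - t) 1 T h ?_)
      rw [dist_eq_norm, sub_sub_cancel]
      rw [Metric.mem_ball, dist_zero_right] at ht
      linarith
    simp [hg _ this]
  · rw [← b.support_normed_eq (μ := volume), Function.notMem_support] at ht
    simp [ht]

/-- The mollification of a function with weak gradient `D` has as gradient the mollification
of `D`. -/
lemma ContDiffBump.gradient_convolution (b : ContDiffBump (0 : Space d)) {f : Space d → ℝ}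
    {D : Space d → Space d} (hf : Continuous f) (hD : LocallyIntegrable D)
    (hw : ∀ ψ : Space d → ℝ, ContDiff ℝ 1 ψ → HasCompactSupport ψ → ∀ e,
      ∫ x, fderiv ℝ ψ x e * f x = -∫ x, ψ x * inner ℝ (D x) e) (x : Space d) :
    gradient (b.normed volume ⋆[ContinuousLinearMap.lsmul ℝ ℝ, volume] f) x =
      (b.normed volume ⋆[ContinuousLinearMap.lsmul ℝ ℝ, volume] D) x := by
  have hb1 : ContDiff ℝ 1 (b.normed volume) := b.contDiff_normed
  have hfl : LocallyIntegrable f := hf.locallyIntegrable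
  have hF := b.hasCompactSupport_normed (μ := volume).hasFDerivAt_convolution_left
    (ContinuousLinearMap.lsmul ℝ ℝ) hb1 hfl x
  have hex := (b.hasCompactSupport_normed (μ := volume).fderiv (𝕜 := ℝ)).convolutionExists_left
    ((ContinuousLinearMap.lsmul ℝ ℝ : ℝ →L[ℝ] ℝ →L[ℝ] ℝ).precompL (Space d))
    (hb1.continuous_fderiv one_ne_zero) hfl x
  have hexD : Integrable fun t => b.normed volume t • D (x - t) := (b.hasCompactSupport_normed (μ := volume)).convolutionExists_left
    (ContinuousLinearMap.lsmul ℝ ℝ) hb1.continuous hD x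
  refine ext_inner_right ℝ fun e => ?_
  rw [inner_gradient_left, hF.fderiv, b.convolution_apply, real_inner_comm,
    ← integral_inner hexD]
  have h1 : (((fderiv ℝ (b.normed volume)) ⋆[(ContinuousLinearMap.lsmul ℝ ℝ : ℝ →L[ℝ] ℝ →L[ℝ] ℝ
      ).precompL (Space d), volume] f) x) e = ∫ t, fderiv ℝ (b.normed volume) t e * f (x - t) := by
    rw [convolution_def, ContinuousLinearMap.integral_apply hex]
    rfl
  rw [h1, ← integral_sub_left_eq_self (fun t => fderiv ℝ (b.normed volume) t e * f (x - t))
    volume x, ← integral_sub_left_eq_self (fun t => inner ℝ e (b.normed volume t • D (x - t)))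
    volume x]
  -- After the substitution `t ↦ x - t`, the claim is the weak gradient identity tested with the
  -- reflected and translated bump.
  have hψ : ContDiff ℝ 1 fun y => b.normed volume (x - y) := hb1.comp (by fun_prop)
  have hψs : HasCompactSupport fun y => b.normed volume (x - y) :=
    (b.hasCompactSupport_normed (μ := volume)).comp_homeomorph (Homeomorph.subLeft x)
  have h2 := hw _ hψ hψs e
  have h3 : ∀ y, fderiv ℝ (fun y => b.normed volume (x - y)) y e =
      -(fderiv ℝ (b.normed volume) (x - y) e) := by
    intro y
    have := ((hb1.differentiable one_ne_zero (x - y)).hasFDerivAt).comp y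
      ((hasFDerivAt_id y).const_sub x)
    have h := this.fderiv
    simp only [Function.comp_def] at h
    rw [h]
    simp
  simp only [h3, neg_mul, integral_neg, neg_inj] at h2
  simp only [sub_sub_cancel]
  rw [h2]
  congr 1
  funext y
  rw [inner_smul_right, real_inner_comm]

/-- A continuous function of compact support with bounded, almost everywhere continuous weak
gradient is a limit of test functions. -/
theorem exists_testFunction_approximation {f : Space d → ℝ} {D : Space d → Space d} {C : ℝ}
    (hf : Continuous f) (hfs : HasCompactSupport f) (hDm : AEStronglyMeasurable D)
    (hDC : ∀ x, ‖D x‖ ≤ C) (hDs : ∀ x ∉ tsupport f, D x = 0) (hDc : ∀ᵐ x, ContinuousAt D x)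
    (hw : ∀ ψ : Space d → ℝ, ContDiff ℝ 1 ψ → HasCompactSupport ψ → ∀ e,
      ∫ x, fderiv ℝ ψ x e * f x = -∫ x, ψ x * inner ℝ (D x) e) :
    ∃ (u : ℕ → Space d → ℝ) (K : Set (Space d)) (M : ℝ), (∀ k, IsTestFunction (u k)) ∧
      IsCompact K ∧ (∀ x ∉ K, f x = 0 ∧ D x = 0) ∧ (∀ k, ∀ x ∉ K, u k x = 0 ∧ gradient (u k) x = 0) ∧
      (∀ x, ‖f x‖ ≤ M ∧ ‖D x‖ ≤ M) ∧ (∀ k x, ‖u k x‖ ≤ M ∧ ‖gradient (u k) x‖ ≤ M) ∧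
      (∀ x, Tendsto (fun k => u k x) atTop (𝓝 (f x))) ∧
      ∀ᵐ x, Tendsto (fun k => gradient (u k) x) atTop (𝓝 (D x)) := by
  have hDl : LocallyIntegrable D := by
    refine Integrable.locallyIntegrable ?_
    refine (integrableOn_iff_integrable_of_support_subset (s := tsupport f) fun x hx => ?_).1 ?_
    · by_contra h
      exact hx (hDs x h)
    · exact Measure.integrableOn_of_bounded (M := C) hfs.isCompact.measure_lt_top.ne hDm
        (Eventually.of_forall hDC)
  obtain ⟨M, hM⟩ := hfs.exists_bound_of_continuous hf
  let b : ℕ → ContDiffBump (0 : Space d) := fun k =>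
    ⟨1 / (2 * ((k : ℝ) + 1)), 1 / ((k : ℝ) + 1), by positivity, by
      have : (0 : ℝ) < (k : ℝ) + 1 := by positivity
      rw [div_lt_div_iff_of_pos_left one_pos (by positivity) this]
      linarith⟩
  have hb1 : ∀ k, (b k).rOut ≤ 1 := fun k => by
    have : (1 : ℝ) ≤ (k : ℝ) + 1 := by linarith [(Nat.cast_nonneg k : (0 : ℝ) ≤ k)]
    exact (div_le_one (by linarith)).2 this
  have hb : Tendsto (fun k => (b k).rOut) atTop (𝓝 0) := tendsto_one_div_add_atTop_nhds_zero_nat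
  have hgrad : ∀ k, gradient ((b k).normed volume ⋆[ContinuousLinearMap.lsmul ℝ ℝ, volume] f) =
      ((b k).normed volume ⋆[ContinuousLinearMap.lsmul ℝ ℝ, volume] D) := fun k =>
    funext fun x => (b k).gradient_convolution hf hDl hw x
  have hf0 : ∀ x ∉ tsupport f, f x = 0 := fun x hx => image_eq_zero_of_notMem_tsupport hx
  have hKc : IsCompact (Metric.cthickening 1 (tsupport f)) := hfs.isCompact.cthickening
  refine ⟨fun k => (b k).normed volume ⋆[ContinuousLinearMap.lsmul ℝ ℝ, volume] f,
    Metric.cthickening 1 (tsupport f), max M C, fun k => ⟨?_, ?_⟩, hKc, fun x hx => ?_,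
    fun k x hx => ⟨?_, ?_⟩, fun x => ⟨?_, ?_⟩, fun k x => ⟨?_, ?_⟩, fun x => ?_, ?_⟩
  · exact ((b k).hasCompactSupport_normed (μ := volume)).contDiff_convolution_left _
      (b k).contDiff_normed hf.locallyIntegrable
  · exact HasCompactSupport.intro hKc fun x hx => (b k).convolution_eq_zero (hb1 k) hf0 hx
  · have hx' : x ∉ tsupport f := fun h => hx (Metric.self_subset_cthickening _ h)
    exact ⟨hf0 x hx', hDs x hx'⟩
  · exact (b k).convolution_eq_zero (hb1 k) hf0 hx
  · rw [hgrad]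
    exact (b k).convolution_eq_zero (hb1 k) hDs hx
  · exact (hM x).trans (le_max_left _ _)
  · exact (hDC x).trans (le_max_right _ _)
  · exact ((b k).norm_convolution_le hM x).trans (le_max_left _ _)
  · rw [hgrad]
    exact ((b k).norm_convolution_le hDC x).trans (le_max_right _ _)
  -- Convergence at every point matters here: the surface measure lives on a Lebesgue null set.
  · exact ContDiffBump.convolution_tendsto_right_of_continuous hb hf x
  · filter_upwards [hDc] with x hx
    simp only [hgrad]
    exact ContDiffBump.convolution_tendsto_right (k := fun _ => x) hb
      (Eventually.of_forall fun _ => hDm) (hx.tendsto.comp tendsto_snd) tendsto_const_nhds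

end Mollification

/-! ### Closability and the generator -/

section Form

variable {d : ℕ} {ρ : Space d → ℝ} {u v : Space d → ℝ}

/-- The measure `ρλ^d`. -/
def bulkMeasure (ρ : Space d → ℝ) : Measure (Space d) :=
  volume.withDensity fun x => ENNReal.ofReal (ρ x)

lemma isFiniteMeasureOnCompacts_bulkMeasure (hρ : Continuous ρ) :
    IsFiniteMeasureOnCompacts (bulkMeasure ρ) := by
  have : IsLocallyFiniteMeasure (bulkMeasure ρ) := IsLocallyFiniteMeasure.withDensity_ofReal hρ
  infer_instance

lemma weightedMeasure_eq (S : Measure (Space d)) (ρ : Space d → ℝ) :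
    weightedMeasure S ρ = bulkMeasure ρ + S.withDensity fun x => ENNReal.ofReal (ρ x) :=
  withDensity_add_measure _ _ _

lemma isFiniteMeasureOnCompacts_weightedMeasure (S : Measure (Space d)) [IsFiniteMeasure S]
    (hρ : Continuous ρ) : IsFiniteMeasureOnCompacts (weightedMeasure S ρ) := by
  have h1 := isFiniteMeasureOnCompacts_bulkMeasure hρ
  have h2 : IsLocallyFiniteMeasure (S.withDensity fun x => ENNReal.ofReal (ρ x)) :=
    IsLocallyFiniteMeasure.withDensity_ofReal hρ
  refine ⟨fun K hK => ?_⟩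
  rw [weightedMeasure_eq, Measure.add_apply]
  exact ENNReal.add_lt_top.2 ⟨hK.measure_lt_top, hK.measure_lt_top⟩

lemma bulkMeasure_le (S : Measure (Space d)) (ρ : Space d → ℝ) :
    bulkMeasure ρ ≤ weightedMeasure S ρ := by
  rw [weightedMeasure_eq]
  exact Measure.le_add_right le_rfl

lemma integral_withDensity_ofReal {μ : Measure (Space d)} (hρ : Continuous ρ)
    (hpos : ∀ x, 0 < ρ x) (g : Space d → ℝ) :
    ∫ x, g x ∂(μ.withDensity fun x => ENNReal.ofReal (ρ x)) = ∫ x, g x * ρ x ∂μ := by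
  rw [integral_withDensity_eq_integral_toReal_smul (by fun_prop)
    (Eventually.of_forall fun x => ENNReal.ofReal_lt_top)]
  congr 1
  funext x
  rw [ENNReal.toReal_ofReal (hpos x).le, smul_eq_mul, mul_comm]

lemma inner_toLp_bulkMeasure (hρ : Continuous ρ) (hpos : ∀ x, 0 < ρ x) {F G : Space d → Space d}
    (hF : MemLp F 2 (bulkMeasure ρ)) (hG : MemLp G 2 (bulkMeasure ρ)) :
    inner ℝ (hF.toLp F) (hG.toLp G) = ∫ x, inner ℝ (F x) (G x) * ρ x := by
  rw [L2.inner_def, ← integral_withDensity_ofReal hρ hpos]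
  refine integral_congr_ae ?_
  filter_upwards [hF.coeFn_toLp, hG.coeFn_toLp] with x h1 h2
  rw [h1, h2]

lemma continuous_gradient (hu : ContDiff ℝ 1 u) : Continuous (gradient u) :=
  (InnerProductSpace.toDual ℝ (Space d)).symm.continuous.comp
    (hu.continuous_fderiv one_ne_zero)

namespace IsTestFunction

lemma contDiff_one (hu : IsTestFunction u) : ContDiff ℝ 1 u :=
  hu.1.of_le (by exact_mod_cast le_top)

lemma sub (hu : IsTestFunction u) (hv : IsTestFunction v) : IsTestFunction (u - v) :=
  ⟨hu.1.sub hv.1, HasCompactSupport.sub hu.2 hv.2⟩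

lemma hasCompactSupport_gradient (hu : IsTestFunction u) : HasCompactSupport (gradient u) :=
  (hu.2.fderiv (𝕜 := ℝ)).comp_left (g := (InnerProductSpace.toDual ℝ (Space d)).symm) (map_zero _)

lemma memLp (hu : IsTestFunction u) (μ : Measure (Space d)) [IsFiniteMeasureOnCompacts μ] :
    MemLp u 2 μ :=
  hu.1.continuous.memLp_of_hasCompactSupport hu.2

lemma memLp_gradient (hρ : Continuous ρ) (hu : IsTestFunction u) :
    MemLp (gradient u) 2 (bulkMeasure ρ) :=
  have := isFiniteMeasureOnCompacts_bulkMeasure hρ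
  (continuous_gradient hu.contDiff_one).memLp_of_hasCompactSupport hu.hasCompactSupport_gradient

/-- The gradient of a test function, as an element of `L²(ρλ^d)`. -/
def gradientLp (hρ : Continuous ρ) (hu : IsTestFunction u) : Lp (Space d) 2 (bulkMeasure ρ) :=
  (hu.memLp_gradient hρ).toLp (gradient u)

lemma gradient_sub (hu : IsTestFunction u) (hv : IsTestFunction v) :
    gradient (u - v) = gradient u - gradient v := by
  funext x
  simp only [gradient, Pi.sub_apply]
  rw [fderiv_sub (hu.contDiff_one.differentiable one_ne_zero x)
    (hv.contDiff_one.differentiable one_ne_zero x), map_sub]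

lemma gradientLp_sub (hρ : Continuous ρ) (hu : IsTestFunction u) (hv : IsTestFunction v) :
    (hu.sub hv).gradientLp hρ = hu.gradientLp hρ - hv.gradientLp hρ := by
  rw [gradientLp, gradientLp, gradientLp, ← MemLp.toLp_sub]
  refine MemLp.toLp_congr _ _ ?_
  rw [hu.gradient_sub hv]

lemma preForm_eq_inner (hρ : Continuous ρ) (hpos : ∀ x, 0 < ρ x) (hu : IsTestFunction u)
    (hv : IsTestFunction v) :
    preForm ρ u v = inner ℝ (hu.gradientLp hρ) (hv.gradientLp hρ) :=
  (inner_toLp_bulkMeasure hρ hpos _ _).symm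

lemma preForm_sub_self (hρ : Continuous ρ) (hpos : ∀ x, 0 < ρ x) (hu : IsTestFunction u)
    (hv : IsTestFunction v) :
    preForm ρ (u - v) (u - v) = dist (hu.gradientLp hρ) (hv.gradientLp hρ) ^ 2 := by
  rw [(hu.sub hv).preForm_eq_inner hρ hpos (hu.sub hv), real_inner_self_eq_norm_sq,
    gradientLp_sub hρ hu hv, dist_eq_norm]

/-- The form is represented in `L²(ρλ^d)` by a function if its second argument is fixed. -/
lemma exists_inner_gradientLp_eq (hρ : ContDiff ℝ 1 ρ) (hpos : ∀ x, 0 < ρ x)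
    {m : Space d → ℝ} (hm : IsTestFunction m) :
    ∃ b : Space d → ℝ, Continuous b ∧ HasCompactSupport b ∧ ∀ u, ∀ hu : IsTestFunction u,
      inner ℝ (hu.gradientLp hρ.continuous) (hm.gradientLp hρ.continuous) =
        ∫ x, u x * b x * ρ x := by
  set e := EuclideanSpace.basisFun (Fin d) ℝ
  let q : Fin d → Space d → ℝ := fun i x => ρ x * fderiv ℝ m x (e i)
  have hq : ∀ i, ContDiff ℝ 1 (q i) := fun i =>
    hρ.mul ((hm.1.fderiv_right (m := 1) (by norm_cast)).clm_apply contDiff_const)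
  have hqs : ∀ i, HasCompactSupport (q i) := fun i =>
    HasCompactSupport.mul_left (hm.2.fderiv_apply (𝕜 := ℝ) (e i))
  have hqc : ∀ i, Continuous fun x => fderiv ℝ (q i) x (e i) := fun i =>
    ((hq i).continuous_fderiv one_ne_zero).clm_apply continuous_const
  -- The witness is `-div(ρ∇m)/ρ`, obtained by moving all derivatives onto `m`; dividing by `ρ`
  -- compensates the weight.
  refine ⟨fun x => -(∑ i, fderiv ℝ (q i) x (e i)) / ρ x, ?_, ?_, fun u hu => ?_⟩
  · exact ((continuous_finsetSum _ fun i _ => hqc i).neg).div hρ.continuous fun x => (hpos x).ne'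
  · refine HasCompactSupport.intro (K := tsupport m) hm.2 fun x hx => ?_
    have : ∀ i, fderiv ℝ (q i) x (e i) = 0 := fun i => by
      have h : q i =ᶠ[𝓝 x] fun _ => 0 := by
        filter_upwards [(isClosed_tsupport m).isOpen_compl.mem_nhds hx] with y hy
        have : fderiv ℝ m y = 0 :=
          image_eq_zero_of_notMem_tsupport fun h => hy (tsupport_fderiv_subset ℝ h)
        simp [q, this]
      rw [h.fderiv_eq]
      simp
    simp [this]
  · rw [← preForm_eq_inner hρ.continuous hpos hu hm, preForm]
    have hu1 := hu.contDiff_one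
    have hprod : ∀ i x, fderiv ℝ (fun x => u x * q i x) x (e i) =
        u x * fderiv ℝ (q i) x (e i) + q i x * fderiv ℝ u x (e i) := fun i x => by
      rw [fderiv_fun_mul (hu1.differentiable one_ne_zero x) ((hq i).differentiable one_ne_zero x)]
      simp
    have hz : ∀ i, Integrable (fun x => fderiv ℝ (fun x => u x * q i x) x (e i)) ∧
        ∫ x, fderiv ℝ (fun x => u x * q i x) x (e i) = 0 := fun i =>
      (hu1.mul (hq i)).integral_fderiv_eq_zero hu.2.mul_right (e i)
    have hsum : ∫ x, ∑ i, fderiv ℝ (fun x => u x * q i x) x (e i) = 0 := by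
      rw [integral_finsetSum _ fun i _ => (hz i).1]
      exact Finset.sum_eq_zero fun i _ => (hz i).2
    have hi1 : Integrable fun x => u x * (-(∑ i, fderiv ℝ (q i) x (e i)) / ρ x) * ρ x := by
      refine Continuous.integrable_of_hasCompactSupport ?_ hu.2.mul_right.mul_right
      exact (hu1.continuous.mul (((continuous_finsetSum _ fun i _ => hqc i).neg).div
        hρ.continuous fun x => (hpos x).ne')).mul hρ.continuous
    rw [← sub_eq_zero, ← integral_sub ?_ hi1, ← hsum]
    · congr 1
      funext x
      simp only [hprod]
      rw [← e.sum_inner_mul_inner, Finset.sum_add_distrib, ← Finset.mul_sum, mul_assoc,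
        div_mul_cancel₀ _ (hpos x).ne', Finset.sum_mul]
      have : ∀ i, inner ℝ (gradient u x) (e i) * inner ℝ (e i) (gradient m x) * ρ x =
          q i x * fderiv ℝ u x (e i) := fun i => by
        rw [inner_gradient_left, real_inner_comm, inner_gradient_left]
        simp only [q]
        ring
      simp only [this]
      ring
    · refine Continuous.integrable_of_hasCompactSupport ?_ ?_
      · exact ((continuous_gradient hu1).inner (continuous_gradient hm.contDiff_one)).mul
          hρ.continuous
      · refine HasCompactSupport.intro (K := tsupport u) hu.2 fun x hx => ?_
        have : gradient u x = 0 := by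
          have h0 : fderiv ℝ u x = 0 :=
            image_eq_zero_of_notMem_tsupport fun h => hx (tsupport_fderiv_subset ℝ h)
          simp [gradient, h0]
        simp [this]

end IsTestFunction

variable {S : Measure (Space d)}

lemma IsApproximation.cauchySeq_gradientLp {f : Lp ℝ 2 (weightedMeasure S ρ)}
    {u : ℕ → Space d → ℝ} (hρ : Continuous ρ) (hpos : ∀ x, 0 < ρ x)
    (h : IsApproximation S ρ f u) : CauchySeq fun k => (h.1 k).gradientLp hρ := by
  rw [cauchySeq_iff_tendsto_dist_atTop_0]
  have h1 := (Real.continuous_sqrt.tendsto 0).comp h.2.2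
  rw [Real.sqrt_zero] at h1
  refine h1.congr fun p => ?_
  rw [Function.comp_apply, (h.1 p.1).preForm_sub_self hρ hpos (h.1 p.2), Real.sqrt_sq dist_nonneg]

/-- The form is closable. -/
lemma gradientLp_limit_eq_zero (hρ : ContDiff ℝ 1 ρ) (hpos : ∀ x, 0 < ρ x)
    {u : ℕ → Space d → ℝ} (hu : ∀ k, IsTestFunction (u k))
    (h0 : Tendsto (fun k => eLpNorm (u k) 2 (weightedMeasure S ρ)) atTop (𝓝 0))
    {G : Lp (Space d) 2 (bulkMeasure ρ)}
    (hG : Tendsto (fun k => (hu k).gradientLp hρ.continuous) atTop (𝓝 G)) : G = 0 := by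
  have := isFiniteMeasureOnCompacts_bulkMeasure hρ.continuous
  -- The gradients see only the bulk, and dropping the surface part decreases the norm, so
  -- closability is a matter of `L²(ρλ^d)` alone.
  have hbulk : Tendsto (fun k => ((hu k).memLp (bulkMeasure ρ)).toLp (u k)) atTop (𝓝 0) := by
    have h : Tendsto (fun k => eLpNorm (u k - 0) 2 (bulkMeasure ρ)) atTop (𝓝 0) := by
      refine tendsto_of_tendsto_of_tendsto_of_le_of_le tendsto_const_nhds h0
        (fun _ => zero_le) fun k => ?_
      simpa using eLpNorm_mono_measure (u k) (bulkMeasure_le S ρ)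
    have := (Lp.tendsto_Lp_iff_tendsto_eLpNorm'' u (fun k => (hu k).memLp (bulkMeasure ρ)) 0
      MemLp.zero).2 h
    simpa using this
  have horth : ∀ m, ∀ hm : IsTestFunction m, inner ℝ G (hm.gradientLp hρ.continuous) = (0 : ℝ) := by
    intro m hm
    obtain ⟨b, hb, hbs, hbu⟩ := hm.exists_inner_gradientLp_eq hρ hpos
    have hbm : MemLp b 2 (bulkMeasure ρ) := hb.memLp_of_hasCompactSupport hbs
    have h1 := hG.inner (tendsto_const_nhds (x := hm.gradientLp hρ.continuous)) (𝕜 := ℝ)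
    have h2 := hbulk.inner (tendsto_const_nhds (x := hbm.toLp b)) (𝕜 := ℝ)
    rw [inner_zero_left] at h2
    refine tendsto_nhds_unique h1 (h2.congr fun k => ?_)
    rw [hbu _ (hu k), L2.inner_def, ← integral_withDensity_ofReal hρ.continuous hpos]
    refine integral_congr_ae ?_
    filter_upwards [((hu k).memLp (bulkMeasure ρ)).coeFn_toLp, hbm.coeFn_toLp] with x h1 h2
    rw [h1, h2]
    simp [mul_comm]
  -- `G` is itself a limit of test gradients, to all of which it is orthogonal.
  have h1 := (tendsto_const_nhds (x := G)).inner hG (𝕜 := ℝ)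
  simp only [horth] at h1
  exact inner_self_eq_zero.1 (tendsto_nhds_unique h1 tendsto_const_nhds)

/-- Two approximations of a function have the same limiting gradient. -/
lemma IsApproximation.tendsto_gradientLp (hρ : ContDiff ℝ 1 ρ) (hpos : ∀ x, 0 < ρ x)
    {f : Lp ℝ 2 (weightedMeasure S ρ)} {u v : ℕ → Space d → ℝ} (hu : IsApproximation S ρ f u)
    (hv : IsApproximation S ρ f v) {F : Lp (Space d) 2 (bulkMeasure ρ)}
    (hF : Tendsto (fun k => (hu.1 k).gradientLp hρ.continuous) atTop (𝓝 F)) :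
    Tendsto (fun k => (hv.1 k).gradientLp hρ.continuous) atTop (𝓝 F) := by
  obtain ⟨G, hG⟩ := cauchySeq_tendsto_of_complete (hv.cauchySeq_gradientLp hρ.continuous hpos)
  have hsub : Tendsto (fun k => ((hv.1 k).sub (hu.1 k)).gradientLp hρ.continuous) atTop
      (𝓝 (G - F)) :=
    (hG.sub hF).congr fun k => (IsTestFunction.gradientLp_sub hρ.continuous _ _).symm
  obtain ⟨hu2, hul⟩ := hu.2.1
  obtain ⟨hv2, hvl⟩ := hv.2.1
  have h0 := gradientLp_limit_eq_zero (S := S) hρ hpos (fun k => (hv.1 k).sub (hu.1 k)) ?_ hsub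
  · rwa [sub_eq_zero.1 h0] at hG
  · have h := hvl.sub hul
    rw [sub_self] at h
    have h' := (Lp.tendsto_Lp_iff_tendsto_eLpNorm'' (fun k => v k - u k)
      (fun k => (hv2 k).sub (hu2 k)) 0 MemLp.zero).1 (by
        rw [MemLp.toLp_zero]
        exact h.congr fun k => ((hv2 k).toLp_sub (hu2 k)).symm)
    simpa using h'

/-- A criterion for the domain of the generator. -/
theorem isGeneratorValue_of_approximation (hρ : ContDiff ℝ 1 ρ) (hpos : ∀ x, 0 < ρ x)
    [IsFiniteMeasure S] {f w : Lp ℝ 2 (weightedMeasure S ρ)} {u : ℕ → Space d → ℝ}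
    (hu : IsApproximation S ρ f u) {F : Lp (Space d) 2 (bulkMeasure ρ)}
    (hF : Tendsto (fun k => (hu.1 k).gradientLp hρ.continuous) atTop (𝓝 F))
    (hw : ∀ v, ∀ hv : IsTestFunction v, ∀ hv2 : MemLp v 2 (weightedMeasure S ρ),
      inner ℝ F (hv.gradientLp hρ.continuous) = inner ℝ (-w) (hv2.toLp v)) :
    IsGeneratorValue S ρ f w := by
  have hfd : f ∈ formDomain S ρ := ⟨u, hu⟩
  refine ⟨hfd, fun g hg => ?_⟩
  have h : f ∈ formDomain S ρ ∧ g ∈ formDomain S ρ := ⟨hfd, hg⟩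
  rw [closedForm, dif_pos h]
  refine Tendsto.limUnder_eq ?_
  have hu' := h.1.choose_spec
  have hv' := h.2.choose_spec
  -- `closedForm` is evaluated on sequences picked by choice; closability transfers the limiting
  -- gradient of the given sequence to them.
  have hFu := hu.tendsto_gradientLp hρ hpos hu' hF
  obtain ⟨G, hG⟩ := cauchySeq_tendsto_of_complete (hv'.cauchySeq_gradientLp hρ.continuous hpos)
  have h1 := hFu.inner hG (𝕜 := ℝ)
  have h2 := (tendsto_const_nhds (x := F)).inner hG (𝕜 := ℝ)
  obtain ⟨hv2, hvl⟩ := hv'.2.1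
  have h3 := (tendsto_const_nhds (x := -w)).inner hvl (𝕜 := ℝ)
  -- The identity for test functions is used along the sequence approximating `g`, where both sides
  -- are continuous.
  simp only [hw _ (hv'.1 _) (hv2 _)] at h2
  rw [tendsto_nhds_unique h2 h3] at h1
  refine h1.congr fun k => ?_
  rw [(hu'.1 k).preForm_eq_inner hρ.continuous hpos (hv'.1 k)]

lemma IsTestFunction.mem_formDomain (hv : IsTestFunction v)
    (hv2 : MemLp v 2 (weightedMeasure S ρ)) : hv2.toLp v ∈ formDomain S ρ := by
  refine ⟨fun _ => v, fun _ => hv, ⟨fun _ => hv2, tendsto_const_nhds⟩, ?_⟩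
  have : preForm ρ (v - v) (v - v) = 0 := by
    simp only [preForm, sub_self]
    simp [gradient]
  simp only [this, tendsto_const_nhds_iff]

/-- The value of the generator is unique. -/
lemma IsGeneratorValue.unique [IsFiniteMeasure S] (hρ : Continuous ρ)
    {f w w' : Lp ℝ 2 (weightedMeasure S ρ)} (h : IsGeneratorValue S ρ f w)
    (h' : IsGeneratorValue S ρ f w') : w = w' := by
  have := isFiniteMeasureOnCompacts_weightedMeasure S hρ
  have hloc : ∀ w : Lp ℝ 2 (weightedMeasure S ρ), LocallyIntegrable w (weightedMeasure S ρ) :=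
    fun w => (Lp.memLp w).locallyIntegrable (by norm_num)
  refine Lp.ext (ae_eq_of_integral_contDiff_smul_eq (hloc w) (hloc w') fun g hg hgs => ?_)
  have hgt : IsTestFunction g := ⟨hg, hgs⟩
  have hg2 := hgt.memLp (weightedMeasure S ρ)
  have key : ∀ w : Lp ℝ 2 (weightedMeasure S ρ),
      ∫ x, g x • w x ∂(weightedMeasure S ρ) = inner ℝ w (hg2.toLp g) := fun w => by
    rw [L2.inner_def]
    refine integral_congr_ae ?_
    filter_upwards [hg2.coeFn_toLp] with x hx
    rw [hx]
    simp
  -- Both values pair equally with every test function, which determines a locally integrable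
  -- function almost everywhere.
  have h1 := (h.2 _ (hgt.mem_formDomain hg2)).symm.trans (h'.2 _ (hgt.mem_formDomain hg2))
  rw [inner_neg_left, inner_neg_left, neg_inj] at h1
  rw [key, key, h1]

lemma IsGeneratorValue.generator_eq [IsFiniteMeasure S] (hρ : Continuous ρ)
    {f w : Lp ℝ 2 (weightedMeasure S ρ)} (h : IsGeneratorValue S ρ f w) :
    f ∈ generatorDomain S ρ ∧ generator S ρ f = w := by
  have hf : f ∈ generatorDomain S ρ := ⟨w, h⟩
  refine ⟨hf, ?_⟩
  rw [generator, dif_pos hf]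
  exact hf.choose_spec.unique hρ h

end Form

/-! ### The surface measure in charts -/

section SurfaceMeasure

variable {n : ℕ} {U : Set (Space (n + 1))}

lemma GraphChart.measurable_surfaceElement (c : GraphChart n) : Measurable c.surfaceElement := by
  have h : Measurable (gradient c.φ) :=
    (InnerProductSpace.toDual ℝ (Space n)).symm.continuous.measurable.comp
      (measurable_fderiv ℝ c.φ)
  unfold GraphChart.surfaceElement
  fun_prop

lemma GraphChart.exists_surfaceElement_le (c : GraphChart n) :
    ∃ M : ℝ, ∀ v, c.surfaceElement v ≤ M := by
  obtain ⟨K, hK⟩ := c.exists_bound_fderiv_phi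
  refine ⟨Real.sqrt (1 + K ^ 2), fun v => Real.sqrt_le_sqrt ?_⟩
  have : ‖gradient c.φ v‖ ≤ K := by
    rw [gradient, LinearIsometryEquiv.norm_map]; exact hK v
  gcongr

/-- The part of the surface measure which comes from one chart, on the parameter domain. -/
def GraphChart.localMeasure (c : GraphChart n) (η : Space (n + 1) → ℝ) : Measure (Space n) :=
  (volume.restrict c.box).withDensity fun v =>
    ENNReal.ofReal (η (c.graphMap v) * c.surfaceElement v)

variable (𝒜 : LipschitzAtlas U)
  (η : SmoothPartitionOfUnity (Fin 𝒜.size) 𝓘(ℝ, Space (n + 1)) (Space (n + 1)) (frontier U))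

lemma surfaceMeasure_eq_sum : surfaceMeasure 𝒜 η =
    Measure.sum fun k => ((𝒜.chart k).localMeasure (η k)).map (𝒜.chart k).graphMap := by
  rw [Measure.sum_fintype]
  rfl

lemma measurable_localDensity (k : Fin 𝒜.size) : Measurable fun v =>
    η k ((𝒜.chart k).graphMap v) * (𝒜.chart k).surfaceElement v :=
  ((η k).contMDiff.continuous.measurable.comp (𝒜.chart k).continuous_graphMap.measurable).mul
    (𝒜.chart k).measurable_surfaceElement

lemma localDensity_nonneg (k : Fin 𝒜.size) (v : Space n) :
    0 ≤ η k ((𝒜.chart k).graphMap v) * (𝒜.chart k).surfaceElement v :=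
  mul_nonneg (η.nonneg k _) ((𝒜.chart k).surfaceElement_pos v).le

/-- The Lipschitz constant bounds the surface element, `η k ≤ 1`, and each of the finitely many
boxes is bounded. -/
instance isFiniteMeasure_surfaceMeasure : IsFiniteMeasure (surfaceMeasure 𝒜 η) := by
  have h : ∀ k, IsFiniteMeasure ((𝒜.chart k).localMeasure (η k)) := by
    intro k
    obtain ⟨M, hM⟩ := (𝒜.chart k).exists_surfaceElement_le
    refine isFiniteMeasure_withDensity (ne_of_lt ?_)
    calc ∫⁻ v in (𝒜.chart k).box, ENNReal.ofReal
          (η k ((𝒜.chart k).graphMap v) * (𝒜.chart k).surfaceElement v)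
        ≤ ∫⁻ _ in (𝒜.chart k).box, ENNReal.ofReal M := by
          refine lintegral_mono fun v => ENNReal.ofReal_le_ofReal ?_
          calc _ ≤ 1 * (𝒜.chart k).surfaceElement v := mul_le_mul_of_nonneg_right
                  (η.le_one k _) ((𝒜.chart k).surfaceElement_pos v).le
            _ ≤ M := by rw [one_mul]; exact hM v
      _ < ⊤ := by
          rw [setLIntegral_const]
          exact ENNReal.mul_lt_top ENNReal.ofReal_lt_top
            (𝒜.chart k).isBounded_box.measure_lt_top
  refine ⟨?_⟩
  rw [surfaceMeasure_eq_sum, Measure.sum_fintype, Measure.finsetSum_apply]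
  exact ENNReal.sum_lt_top.2 fun k _ => measure_lt_top _ _

lemma graphMap_mem_frontier (hU : IsOpen U) (k : Fin 𝒜.size) {v : Space n}
    (hv : v ∈ (𝒜.chart k).box) : (𝒜.chart k).graphMap v ∈ frontier U :=
  ((𝒜.isChart k).mem_frontier_iff hU ((𝒜.chart k).graphMap_mem_nbhd.2 hv)).2 (by simp)

lemma localMeasure_absolutelyContinuous (k : Fin 𝒜.size) :
    (𝒜.chart k).localMeasure (η k) ≪ volume.restrict (𝒜.chart k).box :=
  withDensity_absolutelyContinuous _ _

lemma aestronglyMeasurable_surfaceMeasure {h : Space (n + 1) → ℝ}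
    (hm : ∀ k, AEStronglyMeasurable (fun v => h ((𝒜.chart k).graphMap v))
      (volume.restrict (𝒜.chart k).box)) : AEStronglyMeasurable h (surfaceMeasure 𝒜 η) := by
  rw [surfaceMeasure_eq_sum, aestronglyMeasurable_sum_measure_iff]
  intro k
  rw [(𝒜.chart k).measurableEmbedding_graphMap.aestronglyMeasurable_map_iff]
  exact (hm k).mono_ac (localMeasure_absolutelyContinuous 𝒜 η k)

lemma integral_surfaceMeasure {h : Space (n + 1) → ℝ} (hi : Integrable h (surfaceMeasure 𝒜 η)) :
    ∫ x, h x ∂(surfaceMeasure 𝒜 η) = ∑ k, ∫ v in (𝒜.chart k).box,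
      η k ((𝒜.chart k).graphMap v) * (𝒜.chart k).surfaceElement v *
        h ((𝒜.chart k).graphMap v) := by
  rw [surfaceMeasure_eq_sum] at hi ⊢
  rw [integral_sum_measure hi, tsum_fintype]
  refine Finset.sum_congr rfl fun k _ => ?_
  rw [(𝒜.chart k).measurableEmbedding_graphMap.integral_map, GraphChart.localMeasure,
    integral_withDensity_eq_integral_toReal_smul
      (measurable_localDensity 𝒜 η k).ennreal_ofReal
      (Eventually.of_forall fun _ => ENNReal.ofReal_lt_top)]
  congr 1
  funext v
  rw [ENNReal.toReal_ofReal (localDensity_nonneg 𝒜 η k v), smul_eq_mul]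

end SurfaceMeasure

/-! ### Regularity and traces of `f` and of its flux -/

section Regularity

variable {n : ℕ} {U : Set (Space (n + 1))} {f ρ : Space (n + 1) → ℝ}

lemma memLp_two_of_bounded {X E : Type*} [TopologicalSpace X] [T2Space X] [MeasurableSpace X]
    [OpensMeasurableSpace X] [NormedAddCommGroup E] {μ : Measure X} [IsFiniteMeasureOnCompacts μ]
    {F : X → E} {K : Set X} {C : ℝ} (hK : IsCompact K) (hF : AEStronglyMeasurable F μ)
    (hFK : ∀ x ∉ K, F x = 0) (hC : ∀ x, ‖F x‖ ≤ C) : MemLp F 2 μ := by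
  have : F = K.indicator F := (indicator_eq_self.2 fun x hx => by
    by_contra h
    exact hx (hFK x h)).symm
  rw [this, memLp_indicator_iff_restrict hK.measurableSet]
  have : IsFiniteMeasure (μ.restrict K) := ⟨by simpa using hK.measure_lt_top⟩
  exact MemLp.of_bound hF.restrict C (Eventually.of_forall hC)

lemma gradient_eq_zero_of_notMem_tsupport {d : ℕ} {f : Space d → ℝ} {x : Space d}
    (hx : x ∉ tsupport f) : gradient f x = 0 := by
  have h0 : fderiv ℝ f x = 0 :=
    image_eq_zero_of_notMem_tsupport fun h => hx (tsupport_fderiv_subset ℝ h)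
  simp [gradient, h0]

lemma measurable_gradient {d : ℕ} (f : Space d → ℝ) : Measurable (gradient f) :=
  (InnerProductSpace.toDual ℝ (Space d)).symm.continuous.measurable.comp (measurable_fderiv ℝ f)

lemma norm_gradient {d : ℕ} (f : Space d → ℝ) (x : Space d) :
    ‖gradient f x‖ = ‖fderiv ℝ f x‖ := by
  rw [gradient, LinearIsometryEquiv.norm_map]

lemma laplacian_eq_sum_fderiv {d : ℕ} (f : Space d → ℝ) (x : Space d) :
    Laplacian.laplacian f x = ∑ i, fderiv ℝ (fderiv ℝ f) x
      (EuclideanSpace.basisFun (Fin d) ℝ i) (EuclideanSpace.basisFun (Fin d) ℝ i) := by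
  rw [InnerProductSpace.laplacian_eq_iteratedFDeriv_orthonormalBasis f
    (EuclideanSpace.basisFun (Fin d) ℝ)]
  refine Finset.sum_congr rfl fun i _ => ?_
  rw [iteratedFDeriv_two_apply]
  rfl

namespace IsBoundedC2On

lemma contDiffAt (hf : IsBoundedC2On f (frontier U)ᶜ) {x : Space (n + 1)}
    (hx : x ∉ frontier U) : ContDiffAt ℝ 2 f x :=
  hf.1.contDiffAt (isClosed_frontier.isOpen_compl.mem_nhds hx)

lemma differentiableAt (hf : IsBoundedC2On f (frontier U)ᶜ) {x : Space (n + 1)}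
    (hx : x ∉ frontier U) : DifferentiableAt ℝ f x :=
  (hf.contDiffAt hx).differentiableAt two_ne_zero

lemma contDiffAt_fderiv (hf : IsBoundedC2On f (frontier U)ᶜ) {x : Space (n + 1)}
    (hx : x ∉ frontier U) :
    ContDiffAt ℝ 1 (fderiv ℝ f) x :=
  (hf.contDiffAt hx).fderiv_right (by norm_num)

lemma exists_bound (hf : IsBoundedC2On f (frontier U)ᶜ) :
    ∃ C, 0 ≤ C ∧ ∀ x ∉ frontier U, ‖f x‖ ≤ C ∧ ‖fderiv ℝ f x‖ ≤ C ∧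
    ‖fderiv ℝ (fderiv ℝ f) x‖ ≤ C := by
  obtain ⟨C₀, h₀⟩ := hf.2 0 (by norm_num)
  obtain ⟨C₁, h₁⟩ := hf.2 1 (by norm_num)
  obtain ⟨C₂, h₂⟩ := hf.2 2 le_rfl
  refine ⟨max 0 (max C₀ (max C₁ C₂)), le_max_left _ _, fun x hx => ⟨?_, ?_, ?_⟩⟩
  · rw [← norm_iteratedFDeriv_zero (𝕜 := ℝ)]
    exact (h₀ x hx).trans (by simp)
  · rw [← norm_iteratedFDeriv_one]
    exact (h₁ x hx).trans (by simp)
  · rw [← norm_iteratedFDeriv_one, norm_iteratedFDeriv_fderiv]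
    exact (h₂ x hx).trans (by simp)

/-- Continuity gives `f` equal traces from both sides, so its boundary term in the divergence
theorem vanishes. -/
lemma isPiecewiseC1 (hf : IsBoundedC2On f (frontier U)ᶜ)
    (hfc : Continuous f) : IsPiecewiseC1 U f f f := by
  obtain ⟨C, -, hC⟩ := hf.exists_bound
  exact ⟨fun x hx => (hf.contDiffAt hx).of_le one_le_two, ⟨C, fun x hx => (hC x hx).1⟩,
    ⟨C, fun x hx => (hC x hx).2.1⟩, fun x _ => (hfc.tendsto x).mono_left nhdsWithin_le_nhds,
    fun x _ => (hfc.tendsto x).mono_left nhdsWithin_le_nhds⟩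

/-- The components of `ρ∇f` qualify for the divergence theorem. Neither `ρ` nor its derivative need
be bounded globally, so their bounds are taken on the support of `f`. -/
lemma isPiecewiseC1_flux (hf : IsBoundedC2On f (frontier U)ᶜ)
    (hU : IsOpen U) (𝒜 : LipschitzAtlas U) (hρ : ContDiff ℝ 1 ρ)
    (hfs : HasCompactSupport f) (e : Space (n + 1)) :
    IsPiecewiseC1 U (fun x => ρ x * fderiv ℝ f x e)
      (fun x => ρ x * inner ℝ (gradientFrom U f x) e)
      (fun x => ρ x * inner ℝ (gradientFrom (closure U)ᶜ f x) e) := by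
  obtain ⟨C, hC0, hC⟩ := hf.exists_bound
  obtain ⟨R, hR⟩ := hfs.isCompact.exists_bound_of_continuousOn hρ.continuous.continuousOn
  obtain ⟨R', hR'⟩ := hfs.isCompact.exists_bound_of_continuousOn
    (hρ.continuous_fderiv one_ne_zero).continuousOn
  have hz : ∀ x ∉ tsupport f, fderiv ℝ f x = 0 := fun x hx =>
    image_eq_zero_of_notMem_tsupport fun h => hx (tsupport_fderiv_subset ℝ h)
  have hd : ∀ x ∉ frontier U, ContDiffAt ℝ 1 (fun x => fderiv ℝ f x e) x := fun x hx =>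
    (hf.contDiffAt_fderiv hx).clm_apply contDiffAt_const
  have hfe : ∀ x ∉ frontier U, ‖fderiv ℝ f x e‖ ≤ C * ‖e‖ := fun x hx =>
    (ContinuousLinearMap.le_opNorm _ _).trans (by gcongr; exact (hC x hx).2.1)
  refine ⟨fun x hx => hρ.contDiffAt.mul (hd x hx), ⟨max 0 (R * (C * ‖e‖)), fun x hx => ?_⟩,
    ⟨max 0 (R * (C * ‖e‖) + (C * ‖e‖) * R'), fun x hx => ?_⟩, fun x hx => ?_, fun x hx => ?_⟩
  · by_cases hx' : x ∈ tsupport f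
    · refine le_max_of_le_right ?_
      rw [norm_mul]
      have := (norm_nonneg _).trans (hR x hx')
      gcongr
      exacts [hR x hx', hfe x hx]
    · simp [hz x hx']
  · by_cases hx' : x ∈ tsupport f
    · refine le_max_of_le_right ?_
      rw [fderiv_fun_mul (hρ.differentiable one_ne_zero x)
        ((hd x hx).differentiableAt one_ne_zero)]
      refine (norm_add_le _ _).trans ?_
      rw [norm_smul, norm_smul]
      have := (norm_nonneg _).trans (hR x hx')
      have hff : ‖fderiv ℝ (fun x => fderiv ℝ f x e) x‖ ≤ C * ‖e‖ := by
        have h := ((hf.contDiffAt_fderiv hx).differentiableAt one_ne_zero).hasFDerivAt.clm_apply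
          (hasFDerivAt_const e x)
        rw [h.fderiv]
        refine ContinuousLinearMap.opNorm_le_bound _ (by positivity) fun y => ?_
        simp only [ContinuousLinearMap.comp_zero, zero_add, ContinuousLinearMap.flip_apply]
        calc ‖fderiv ℝ (fderiv ℝ f) x y e‖ ≤ ‖fderiv ℝ (fderiv ℝ f) x y‖ * ‖e‖ :=
              ContinuousLinearMap.le_opNorm _ _
          _ ≤ ‖fderiv ℝ (fderiv ℝ f) x‖ * ‖y‖ * ‖e‖ := by
              gcongr; exact ContinuousLinearMap.le_opNorm _ _
          _ ≤ C * ‖y‖ * ‖e‖ := by gcongr; exact (hC x hx).2.2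
          _ = C * ‖e‖ * ‖y‖ := by ring
      gcongr
      exacts [hR x hx', hfe x hx, hR' x hx']
    · have h : (fun x => ρ x * fderiv ℝ f x e) =ᶠ[𝓝 x] fun _ => 0 := by
        filter_upwards [(isClosed_tsupport f).isOpen_compl.mem_nhds hx'] with y hy
        simp [hz y hy]
      rw [h.fderiv_eq]
      simp
  · have h := (𝒜.tendsto_gradientFrom hU hf hx).1
    have h1 := ((hρ.continuous.tendsto x).mono_left nhdsWithin_le_nhds).mul
      (h.inner (tendsto_const_nhds (x := e)) (𝕜 := ℝ))
    simpa only [inner_gradient_left] using h1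
  · have h := (𝒜.tendsto_gradientFrom hU hf hx).2
    have h1 := ((hρ.continuous.tendsto x).mono_left nhdsWithin_le_nhds).mul
      (h.inner (tendsto_const_nhds (x := e)) (𝕜 := ℝ))
    simpa only [inner_gradient_left] using h1

lemma norm_gradientFrom_le (hf : IsBoundedC2On f (frontier U)ᶜ)
    (hU : IsOpen U) (𝒜 : LipschitzAtlas U) {C : ℝ}
    (hC : ∀ x ∉ frontier U, ‖fderiv ℝ f x‖ ≤ C) {x : Space (n + 1)} (hx : x ∈ frontier U) :
    ‖gradientFrom U f x‖ ≤ C ∧ ‖gradientFrom (closure U)ᶜ f x‖ ≤ C := by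
  have h := 𝒜.tendsto_gradientFrom hU hf hx
  have hne := 𝒜.neBot_nhdsWithin hU hx
  have := hne.1
  have := hne.2
  refine ⟨le_of_tendsto h.1.norm ?_, le_of_tendsto h.2.norm ?_⟩
  · filter_upwards [self_mem_nhdsWithin] with y hy
    rw [norm_gradient]
    refine hC y fun h => ?_
    rw [hU.frontier_eq] at h
    exact h.2 hy
  · filter_upwards [self_mem_nhdsWithin] with y hy
    rw [norm_gradient]
    exact hC y fun h => hy (frontier_subset_closure h)

end IsBoundedC2On

end Regularity

/-! ### The Gauss–Green formula for the form -/

section Generator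

variable {n : ℕ} {U : Set (Space (n + 1))} {f ρ : Space (n + 1) → ℝ}

lemma generatorFormula_of_mem {x : Space (n + 1)} (hx : x ∈ frontier U) :
    generatorFormula U ρ f x = inner ℝ
      (gradientFrom (closure U)ᶜ f x - gradientFrom U f x) (outerNormal U x) := by
  simp [generatorFormula, hx, normalDerivFrom, inner_sub_left]

lemma generatorFormula_of_notMem {x : Space (n + 1)} (hx : x ∉ frontier U) :
    generatorFormula U ρ f x = Laplacian.laplacian f x +
      inner ℝ (gradient f x) (gradient (fun z => Real.log (ρ z)) x) := by
  simp [generatorFormula, hx]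

lemma gradient_log {d : ℕ} {ρ : Space d → ℝ} (hρ : ContDiff ℝ 1 ρ) (hpos : ∀ x, 0 < ρ x)
    (x : Space d) : gradient (fun z => Real.log (ρ z)) x = (ρ x)⁻¹ • gradient ρ x := by
  rw [gradient, gradient, fderiv.log (hρ.differentiable one_ne_zero x) (hpos x).ne', map_smul]

namespace IsBoundedC2On

/-- On a graph, each trace is the pointwise limit as `t → 0±` of the measurable maps `v ↦ ∇f (param
(v, t))`. -/
lemma aestronglyMeasurable_gradientFrom (hf : IsBoundedC2On f (frontier U)ᶜ) (hU : IsOpen U)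
    (𝒜 : LipschitzAtlas U) (k : Fin 𝒜.size) :
    AEStronglyMeasurable (fun v => gradientFrom U f ((𝒜.chart k).graphMap v))
      (volume.restrict (𝒜.chart k).box) ∧
    AEStronglyMeasurable (fun v => gradientFrom (closure U)ᶜ f ((𝒜.chart k).graphMap v))
      (volume.restrict (𝒜.chart k).box) := by
  have hm : ∀ t : ℝ, AEStronglyMeasurable (fun v => gradient f ((𝒜.chart k).param (v, t)))
      (volume.restrict (𝒜.chart k).box) := fun t => by
    have h : Continuous fun v => (𝒜.chart k).param (v, t) := by fun_prop
    exact ((measurable_gradient f).comp h.measurable).aestronglyMeasurable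
  have hbox : ∀ᵐ v ∂(volume.restrict (𝒜.chart k).box), v ∈ (𝒜.chart k).box :=
    ae_restrict_mem (𝒜.chart k).isOpen_box.measurableSet
  constructor
  · refine aestronglyMeasurable_of_tendsto_ae (𝓝[>] (0 : ℝ)) hm (hbox.mono fun v hv => ?_)
    exact (𝒜.tendsto_gradientFrom hU hf (graphMap_mem_frontier 𝒜 hU k hv)).1.comp
      ((𝒜.isChart k).tendsto_param_right hv)
  · refine aestronglyMeasurable_of_tendsto_ae (𝓝[<] (0 : ℝ)) hm (hbox.mono fun v hv => ?_)
    exact (𝒜.tendsto_gradientFrom hU hf (graphMap_mem_frontier 𝒜 hU k hv)).2.comp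
      ((𝒜.isChart k).tendsto_param_left hv)

lemma ae_outerNormal_graphMap (hU : IsOpen U) (𝒜 : LipschitzAtlas U) (k : Fin 𝒜.size) :
    ∀ᵐ v ∂(volume.restrict (𝒜.chart k).box), v ∈ (𝒜.chart k).box ∧
      outerNormal U ((𝒜.chart k).graphMap v) = (𝒜.chart k).normal v := by
  filter_upwards [ae_restrict_mem (𝒜.chart k).isOpen_box.measurableSet,
    ae_restrict_of_ae (𝒜.chart k).ae_differentiableAt_phi] with v hv hd
  exact ⟨hv, (𝒜.isChart k).outerNormal_graphMap hU hv hd⟩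

lemma aestronglyMeasurable_generatorFormula_volume (hf : IsBoundedC2On f (frontier U)ᶜ)
    (hU : IsOpen U) (𝒜 : LipschitzAtlas U) (hρ : ContDiff ℝ 1 ρ) (hpos : ∀ x, 0 < ρ x) :
    AEStronglyMeasurable (generatorFormula U ρ f) := by
  have hopen : IsOpen (frontier U)ᶜ := isClosed_frontier.isOpen_compl
  have hc : ContinuousOn (fun x => Laplacian.laplacian f x +
      inner ℝ (gradient f x) (gradient (fun z => Real.log (ρ z)) x)) (frontier U)ᶜ := by
    intro x hx
    have h1 : ContinuousAt (fderiv ℝ (fderiv ℝ f)) x :=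
      ((hf.contDiffAt_fderiv hx).fderiv_right (m := 0) (by norm_num)).continuousAt
    have h2 : ContinuousAt (gradient f) x :=
      ((InnerProductSpace.toDual ℝ (Space (n + 1))).symm.continuous.continuousAt).comp
        (hf.contDiffAt_fderiv hx).continuousAt
    refine ContinuousAt.continuousWithinAt ?_
    simp only [laplacian_eq_sum_fderiv, gradient_log hρ hpos]
    refine ContinuousAt.add (tendsto_finsetSum _ fun i _ =>
      ((h1.clm_apply continuousAt_const).clm_apply continuousAt_const).tendsto) (h2.inner ?_)
    exact (hρ.continuous.continuousAt.inv₀ (hpos x).ne').smul (continuous_gradient hρ).continuousAt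
  have hm := (aestronglyMeasurable_indicator_iff (μ := volume) hopen.measurableSet).2
    (hc.aestronglyMeasurable hopen.measurableSet)
  refine hm.congr ?_
  have hnull : ∀ᵐ x, x ∉ frontier U := by
    simpa [ae_iff] using 𝒜.volume_frontier hU
  filter_upwards [hnull] with x hx
  rw [generatorFormula_of_notMem hx, indicator_of_mem (by exact hx)]

lemma aestronglyMeasurable_generatorFormula_surfaceMeasure (hf : IsBoundedC2On f (frontier U)ᶜ)
    (hU : IsOpen U) (𝒜 : LipschitzAtlas U)
    (η : SmoothPartitionOfUnity (Fin 𝒜.size) 𝓘(ℝ, Space (n + 1)) (Space (n + 1)) (frontier U)) :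
    AEStronglyMeasurable (generatorFormula U ρ f) (surfaceMeasure 𝒜 η) := by
  refine aestronglyMeasurable_surfaceMeasure 𝒜 η fun k => ?_
  have hm := hf.aestronglyMeasurable_gradientFrom hU 𝒜 k
  have hg : Measurable (gradient (𝒜.chart k).φ) := measurable_gradient _
  have hν : Measurable (𝒜.chart k).normal := by
    have : (𝒜.chart k).normal = fun v => ((𝒜.chart k).surfaceElement v)⁻¹ •
        ((𝒜.chart k).liftL (gradient (𝒜.chart k).φ v) +
          (-1 : ℝ) • (𝒜.chart k).basis (Fin.last n)) := funext fun v => (𝒜.chart k).normal_eq v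
    rw [this]
    exact (𝒜.chart k).measurable_surfaceElement.inv.smul
      (((𝒜.chart k).liftL.continuous.measurable.comp hg).add_const _)
  refine ((hm.2.sub hm.1).inner (𝕜 := ℝ) hν.aestronglyMeasurable).congr ?_
  filter_upwards [ae_outerNormal_graphMap hU 𝒜 k] with v hv
  rw [generatorFormula_of_mem (graphMap_mem_frontier 𝒜 hU k hv.1), hv.2]
  rfl

/-- Boundedness of `U` makes `∂U` compact. Together with measurability, this puts the formula in L²
of any measure finite on compact sets. -/
lemma exists_bound_generatorFormula (hf : IsBoundedC2On f (frontier U)ᶜ) (hU : IsOpen U)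
    (hUb : Bornology.IsBounded U) (𝒜 : LipschitzAtlas U) (hρ : ContDiff ℝ 1 ρ)
    (hpos : ∀ x, 0 < ρ x) (hfs : HasCompactSupport f) :
    ∃ (K : Set (Space (n + 1))) (C : ℝ), IsCompact K ∧ (∀ x ∉ K, generatorFormula U ρ f x = 0) ∧
      ∀ x, ‖generatorFormula U ρ f x‖ ≤ C := by
  obtain ⟨C, hC0, hC⟩ := hf.exists_bound
  have hcont : Continuous fun x => (ρ x)⁻¹ • gradient ρ x :=
    (hρ.continuous.inv₀ fun x => (hpos x).ne').smul (continuous_gradient hρ)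
  obtain ⟨R, hR⟩ := hfs.isCompact.exists_bound_of_continuousOn hcont.continuousOn
  have hA : IsCompact (frontier U) :=
    Metric.isCompact_of_isClosed_isBounded isClosed_frontier
      (hUb.closure.subset frontier_subset_closure)
  have hz : ∀ x ∉ tsupport f, x ∉ frontier U → generatorFormula U ρ f x = 0 := by
    intro x hx hxU
    have hd : fderiv ℝ (fderiv ℝ f) x = 0 := image_eq_zero_of_notMem_tsupport fun h =>
      hx (tsupport_fderiv_subset ℝ (tsupport_fderiv_subset ℝ h))
    rw [generatorFormula_of_notMem hxU, laplacian_eq_sum_fderiv,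
      gradient_eq_zero_of_notMem_tsupport hx, hd]
    simp
  refine ⟨tsupport f ∪ frontier U, max (2 * C) ((n + 1) * C + C * R), hfs.isCompact.union hA,
    fun x hx => hz x (fun h => hx (Or.inl h)) fun h => hx (Or.inr h), fun x => ?_⟩
  by_cases hxU : x ∈ frontier U
  · refine le_max_of_le_left ?_
    rw [generatorFormula_of_mem hxU]
    have h := hf.norm_gradientFrom_le hU 𝒜 (fun y hy => (hC y hy).2.1) hxU
    calc _ ≤ ‖gradientFrom (closure U)ᶜ f x - gradientFrom U f x‖ * ‖outerNormal U x‖ :=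
          norm_inner_le_norm _ _
      _ ≤ (C + C) * 1 := by
          gcongr
          · exact (norm_sub_le _ _).trans (add_le_add h.2 h.1)
          · exact norm_outerNormal_le x
      _ = 2 * C := by ring
  · by_cases hx : x ∈ tsupport f
    · refine le_max_of_le_right ?_
      rw [generatorFormula_of_notMem hxU, laplacian_eq_sum_fderiv, gradient_log hρ hpos]
      refine (norm_add_le _ _).trans (add_le_add ?_ ?_)
      · refine (norm_sum_le _ _).trans ?_
        calc _ ≤ ∑ _i : Fin (n + 1), C := Finset.sum_le_sum fun i _ => by
              have h1 : ‖EuclideanSpace.basisFun (Fin (n + 1)) ℝ i‖ = 1 :=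
                (EuclideanSpace.basisFun (Fin (n + 1)) ℝ).orthonormal.1 i
              refine (ContinuousLinearMap.le_opNorm₂ _ _ _).trans ?_
              rw [h1, mul_one, mul_one]
              exact (hC x hxU).2.2
          _ = _ := by simp
      · refine (norm_inner_le_norm _ _).trans ?_
        rw [norm_gradient]
        have := (hC x hxU).2.1
        have := hR x hx
        gcongr
    · rw [hz x hx hxU, norm_zero]
      exact le_max_of_le_left (by positivity)

end IsBoundedC2On

/-- The Gauss–Green formula for the form, with test functions as second argument. -/
theorem integral_inner_gradient_eq (hf : IsBoundedC2On f (frontier U)ᶜ) (hU : IsOpen U)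
    (hUb : Bornology.IsBounded U) (𝒜 : LipschitzAtlas U)
    (η : SmoothPartitionOfUnity (Fin 𝒜.size) 𝓘(ℝ, Space (n + 1)) (Space (n + 1)) (frontier U))
    (hη : η.IsSubordinate fun k => (𝒜.chart k).nbhd) (hρ : ContDiff ℝ 1 ρ) (hpos : ∀ x, 0 < ρ x)
    (hfs : HasCompactSupport f) {v : Space (n + 1) → ℝ} (hv : IsTestFunction v) :
    ∫ x, inner ℝ (gradient f x) (gradient v x) * ρ x =
      -∫ x, generatorFormula U ρ f x * v x ∂(weightedMeasure (surfaceMeasure 𝒜 η) ρ) := by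
  set w := generatorFormula U ρ f
  set S := surfaceMeasure 𝒜 η
  set e := EuclideanSpace.basisFun (Fin (n + 1)) ℝ
  have hv1 := hv.contDiff_one
  obtain ⟨K, M, hK, hwK, hwM⟩ := hf.exists_bound_generatorFormula hU hUb 𝒜 hρ hpos hfs
  have hvρ : Continuous fun x => v x * ρ x := hv1.continuous.mul hρ.continuous
  have hvρs : HasCompactSupport fun x => v x * ρ x := hv.2.mul_right
  have hwV : MemLp w 2 volume := memLp_two_of_bounded hK
    (hf.aestronglyMeasurable_generatorFormula_volume hU 𝒜 hρ hpos) hwK hwM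
  have hwS : MemLp w 2 S := memLp_two_of_bounded hK
    (hf.aestronglyMeasurable_generatorFormula_surfaceMeasure hU 𝒜 η) hwK hwM
  have hiV : Integrable (fun x => w x * (v x * ρ x)) volume :=
    hwV.integrable_mul (hvρ.memLp_of_hasCompactSupport hvρs (p := 2))
  have hiS : Integrable (fun x => w x * (v x * ρ x)) S :=
    hwS.integrable_mul (hvρ.memLp_of_hasCompactSupport hvρs (p := 2))
  have hsplit : ∫ x, w x * v x ∂(weightedMeasure S ρ) =
      (∫ x, w x * (v x * ρ x)) + ∫ x, w x * (v x * ρ x) ∂S := by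
    rw [weightedMeasure, integral_withDensity_ofReal hρ.continuous hpos,
      ← integral_add_measure hiV hiS]
    simp only [mul_assoc]
  have hnull : ∀ᵐ x, x ∉ frontier U := by
    simpa [ae_iff] using 𝒜.volume_frontier hU
  let q : Fin (n + 1) → Space (n + 1) → ℝ := fun i x => ρ x * fderiv ℝ f x (e i)
  have hGG := fun i => (hf.isPiecewiseC1_flux hU 𝒜 hρ hfs (e i)).integral_fderiv_mul hU 𝒜 η hη
    hv1 hv.2 (e i)
  -- The product rule for `div(vρ∇f)`, with `⟨∇f,∇ρ⟩ = ρ⟨∇f,∇ln ρ⟩`.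
  have hdiv : (fun x => ∑ i, fderiv ℝ (fun x => v x * q i x) x (e i)) =ᵐ[volume]
      fun x => inner ℝ (gradient f x) (gradient v x) * ρ x + w x * (v x * ρ x) := by
    filter_upwards [hnull] with x hx
    have hd : ∀ i, fderiv ℝ (q i) x (e i) = ρ x * fderiv ℝ (fderiv ℝ f) x (e i) (e i) +
        fderiv ℝ f x (e i) * fderiv ℝ ρ x (e i) := fun i => by
      have h := (hρ.differentiable one_ne_zero x).hasFDerivAt.mul
        (((hf.contDiffAt_fderiv hx).differentiableAt one_ne_zero).hasFDerivAt.clm_apply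
          (hasFDerivAt_const (e i) x))
      have h' : fderiv ℝ (q i) x = _ := h.fderiv
      rw [h']
      simp
    have hdd : ∀ i, DifferentiableAt ℝ (q i) x := fun i =>
      ((hf.isPiecewiseC1_flux hU 𝒜 hρ hfs (e i)).contDiffAt x hx).differentiableAt one_ne_zero
    have hterm : ∀ i, fderiv ℝ (fun x => v x * q i x) x (e i) =
        (inner ℝ (gradient f x) (e i) * inner ℝ (e i) (gradient v x)) * ρ x +
        (fderiv ℝ (fderiv ℝ f) x (e i) (e i)) * (v x * ρ x) +
        (inner ℝ (gradient f x) (e i) * inner ℝ (e i) (gradient ρ x)) * v x := fun i => by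
      rw [fderiv_fun_mul (hv1.differentiable one_ne_zero x) (hdd i)]
      simp only [add_apply, smul_apply, smul_eq_mul, hd]
      rw [real_inner_comm (gradient v x), real_inner_comm (gradient ρ x), inner_gradient_left,
        inner_gradient_left, inner_gradient_left]
      simp only [q]
      ring
    have hw : w x = Laplacian.laplacian f x + (ρ x)⁻¹ * inner ℝ (gradient f x) (gradient ρ x) := by
      rw [← inner_smul_right, ← gradient_log hρ hpos]
      exact generatorFormula_of_notMem hx
    simp only [hterm]
    rw [Finset.sum_add_distrib, Finset.sum_add_distrib, ← Finset.sum_mul, ← Finset.sum_mul,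
      ← Finset.sum_mul, e.sum_inner_mul_inner, e.sum_inner_mul_inner, ← laplacian_eq_sum_fderiv, hw]
    have := (hpos x).ne'
    field_simp
    ring
  have hsum : ∫ x, ∑ i, fderiv ℝ (fun x => v x * q i x) x (e i) =
      ∑ i, ∫ x, fderiv ℝ (fun x => v x * q i x) x (e i) :=
    integral_finsetSum _ fun i _ => (hGG i).1
  have hiF : Integrable fun x => inner ℝ (gradient f x) (gradient v x) * ρ x := by
    have h : Integrable fun x => ∑ i, fderiv ℝ (fun x => v x * q i x) x (e i) :=
      integrable_finsetSum _ fun i _ => (hGG i).1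
    refine ((h.congr hdiv).sub hiV).congr (Eventually.of_forall fun x => ?_)
    simp
  rw [integral_congr_ae hdiv, integral_add hiF hiV] at hsum
  obtain ⟨C, hC0, hC⟩ := hf.exists_bound
  obtain ⟨R, hR⟩ := hvρs.exists_bound_of_continuous hvρ
  have hbd : ∑ i, ∫ x, fderiv ℝ (fun x => v x * q i x) x (e i) =
      -∫ x, w x * (v x * ρ x) ∂S := by
    rw [integral_surfaceMeasure 𝒜 η hiS, ← Finset.sum_neg_distrib]
    simp only [q, (hGG _).2]
    rw [Finset.sum_comm]
    refine Finset.sum_congr rfl fun k _ => ?_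
    set c := 𝒜.chart k
    rw [← integral_finsetSum, ← integral_neg]
    · refine integral_congr_ae ?_
      filter_upwards [IsBoundedC2On.ae_outerNormal_graphMap hU 𝒜 k] with y hy
      have hmem := graphMap_mem_frontier 𝒜 hU k hy.1
      set g := gradientFrom U f (c.graphMap y) - gradientFrom (closure U)ᶜ f (c.graphMap y) with hg
      have hw : w (c.graphMap y) = -inner ℝ g (c.normal y) := by
        have h : w (c.graphMap y) = _ := generatorFormula_of_mem hmem
        rw [h, hy.2, hg, ← neg_sub, inner_neg_left]
      -- Summing over the directions reassembles the jump vector `g` by linearity, after which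
      -- `inner_normal` produces the density of the surface measure.
      have hlin : ∑ i, inner ℝ g (e i) *
          (fderiv ℝ c.φ y (c.horiz (e i)) - c.vert (e i)) =
          fderiv ℝ c.φ y (c.horiz g) - c.vert g := by
        have h := congrArg ((fderiv ℝ c.φ y).comp c.horizL - c.vertL) (e.sum_repr' g)
        rw [map_sum] at h
        simp only [map_smul, sub_apply, ContinuousLinearMap.comp_apply,
          GraphChart.horizL_apply, GraphChart.vertL_apply, smul_eq_mul] at h
        rw [← h]
        exact Finset.sum_congr rfl fun i _ => by rw [real_inner_comm]
      rw [hw]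
      have hin := c.inner_normal g y
      calc _ = η k (c.graphMap y) * (v (c.graphMap y) * ρ (c.graphMap y)) *
            ∑ i, inner ℝ g (e i) * (fderiv ℝ c.φ y (c.horiz (e i)) - c.vert (e i)) := by
              rw [Finset.mul_sum]
              refine Finset.sum_congr rfl fun i _ => ?_
              rw [hg, inner_sub_left]
              ring
        _ = _ := by
              rw [hlin, ← hin]
              ring
    · intro i _
      have hm := hf.aestronglyMeasurable_gradientFrom hU 𝒜 k
      obtain ⟨L, hL⟩ := c.exists_bound_fderiv_phi
      have he : ‖e i‖ = 1 := e.orthonormal.1 i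
      have hae : ∀ᵐ y ∂(volume.restrict c.box),
          ‖η k (c.graphMap y) * v (c.graphMap y) *
            (ρ (c.graphMap y) * inner ℝ (gradientFrom U f (c.graphMap y)) (e i) -
              ρ (c.graphMap y) * inner ℝ (gradientFrom (closure U)ᶜ f (c.graphMap y)) (e i)) *
            (fderiv ℝ c.φ y (c.horiz (e i)) - c.vert (e i))‖ ≤
          1 * R * (C + C) * (L * ‖c.horiz (e i)‖ + ‖c.vert (e i)‖) := by
        filter_upwards [ae_restrict_mem c.isOpen_box.measurableSet] with y hy
        have hmem := graphMap_mem_frontier 𝒜 hU k hy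
        have hgC := hf.norm_gradientFrom_le hU 𝒜 (fun y hy => (hC y hy).2.1) hmem
        have heq : ∀ a b r s t z : ℝ, a * b * (r * s - r * t) * z = a * (b * r) * (s - t) * z :=
          fun a b r s t z => by ring
        rw [heq, norm_mul, norm_mul, norm_mul]
        have hRnn := (norm_nonneg _).trans (hR (c.graphMap y))
        have h1 : ‖η k (c.graphMap y)‖ ≤ 1 := by
          rw [Real.norm_of_nonneg (η.nonneg k _)]; exact η.le_one k _
        have h2 : ‖inner ℝ (gradientFrom U f (c.graphMap y)) (e i) -
            inner ℝ (gradientFrom (closure U)ᶜ f (c.graphMap y)) (e i)‖ ≤ C + C := by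
          refine (norm_sub_le _ _).trans (add_le_add ?_ ?_)
          · refine (norm_inner_le_norm _ _).trans ?_
            rw [he, mul_one]; exact hgC.1
          · refine (norm_inner_le_norm _ _).trans ?_
            rw [he, mul_one]; exact hgC.2
        have h3 : ‖fderiv ℝ c.φ y (c.horiz (e i)) - c.vert (e i)‖ ≤
            L * ‖c.horiz (e i)‖ + ‖c.vert (e i)‖ := by
          refine (norm_sub_le _ _).trans ?_
          gcongr
          exact (ContinuousLinearMap.le_opNorm _ _).trans (by gcongr; exact hL y)
        have h4 := hR (c.graphMap y)
        gcongr
      have : IsFiniteMeasure (volume.restrict c.box) :=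
        ⟨by simpa using c.isBounded_box.measure_lt_top⟩
      refine Integrable.of_bound ?_ _ hae
      have hcη : Continuous fun y => η k (c.graphMap y) :=
        (η k).contMDiff.continuous.comp c.continuous_graphMap
      have hcv : Continuous fun y => v (c.graphMap y) := hv1.continuous.comp c.continuous_graphMap
      have hcρ : Continuous fun y => ρ (c.graphMap y) := hρ.continuous.comp c.continuous_graphMap
      have hce : AEStronglyMeasurable (fun _ : Space n => e i) (volume.restrict c.box) :=
        aestronglyMeasurable_const
      exact ((hcη.aestronglyMeasurable.mul hcv.aestronglyMeasurable).mul
        ((hcρ.aestronglyMeasurable.mul (hm.1.inner (𝕜 := ℝ) hce)).sub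
          (hcρ.aestronglyMeasurable.mul (hm.2.inner (𝕜 := ℝ) hce)))).mul
        ((measurable_fderiv_apply_const ℝ c.φ _).sub_const _).aestronglyMeasurable
  rw [hbd] at hsum
  rw [hsplit]
  linarith

end Generator

/-! ### Approximation of `f` and identification of the generator -/

section MainTheorem

variable {n : ℕ} {U : Set (Space (n + 1))} {f ρ : Space (n + 1) → ℝ}

/-- The pointwise gradient is a weak gradient, as `f` does not jump across `∂U`. -/
lemma integral_fderiv_mul_eq_neg (hf : IsBoundedC2On f (frontier U)ᶜ) (hU : IsOpen U)
    (𝒜 : LipschitzAtlas U)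
    (η : SmoothPartitionOfUnity (Fin 𝒜.size) 𝓘(ℝ, Space (n + 1)) (Space (n + 1)) (frontier U))
    (hη : η.IsSubordinate fun k => (𝒜.chart k).nbhd) (hfc : Continuous f)
    {ψ : Space (n + 1) → ℝ} (hψ : ContDiff ℝ 1 ψ) (hψs : HasCompactSupport ψ)
    (e : Space (n + 1)) :
    ∫ x, fderiv ℝ ψ x e * f x = -∫ x, ψ x * inner ℝ (gradient f x) e := by
  have hGG := (hf.isPiecewiseC1 hfc).integral_fderiv_mul hU 𝒜 η hη hψ hψs e
  simp only [sub_self, mul_zero, zero_mul, integral_zero, Finset.sum_const_zero] at hGG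
  have hnull : ∀ᵐ x, x ∉ frontier U := by
    simpa [ae_iff] using 𝒜.volume_frontier hU
  have hi : Integrable fun x => fderiv ℝ ψ x e * f x :=
    (((hψ.continuous_fderiv one_ne_zero).clm_apply continuous_const).mul
      hfc).integrable_of_hasCompactSupport (hψs.fderiv_apply (𝕜 := ℝ) e).mul_right
  have hae : (fun x => fderiv ℝ (fun x => ψ x * f x) x e - fderiv ℝ ψ x e * f x) =ᵐ[volume]
      fun x => ψ x * inner ℝ (gradient f x) e := by
    filter_upwards [hnull] with x hx
    rw [fderiv_fun_mul (hψ.differentiable one_ne_zero x) (hf.differentiableAt hx),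
      inner_gradient_left]
    simp only [add_apply, smul_apply, smul_eq_mul]
    ring
  rw [← integral_congr_ae hae, integral_sub hGG.1 hi, hGG.2]
  ring

/-- Mollification supplies the approximating sequence, and the Gauss–Green formula supplies the
identity required by `isGeneratorValue_of_approximation`. -/
theorem isGeneratorValue_generatorFormula (hU : IsOpen U) (hUb : Bornology.IsBounded U)
    (𝒜 : LipschitzAtlas U)
    (η : SmoothPartitionOfUnity (Fin 𝒜.size) 𝓘(ℝ, Space (n + 1)) (Space (n + 1)) (frontier U))
    (hη : η.IsSubordinate fun k => (𝒜.chart k).nbhd) (hρ : ContDiff ℝ 1 ρ) (hpos : ∀ x, 0 < ρ x)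
    (hfc : Continuous f) (hfs : HasCompactSupport f) (hf : IsBoundedC2On f (frontier U)ᶜ)
    (hf2 : MemLp f 2 (weightedMeasure (surfaceMeasure 𝒜 η) ρ)) :
    ∃ hw2 : MemLp (generatorFormula U ρ f) 2 (weightedMeasure (surfaceMeasure 𝒜 η) ρ),
      IsGeneratorValue (surfaceMeasure 𝒜 η) ρ (hf2.toLp f) (hw2.toLp _) := by
  set S := surfaceMeasure 𝒜 η
  have hfin := isFiniteMeasureOnCompacts_weightedMeasure S hρ.continuous
  have hfinb := isFiniteMeasureOnCompacts_bulkMeasure hρ.continuous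
  have hbulk : bulkMeasure ρ ≪ volume := withDensity_absolutelyContinuous _ _
  obtain ⟨K₀, M₀, hK₀, hwK, hwM⟩ := hf.exists_bound_generatorFormula hU hUb 𝒜 hρ hpos hfs
  have hwm : AEStronglyMeasurable (generatorFormula U ρ f) (weightedMeasure S ρ) :=
    ((aestronglyMeasurable_add_measure_iff).2
      ⟨hf.aestronglyMeasurable_generatorFormula_volume hU 𝒜 hρ hpos,
        hf.aestronglyMeasurable_generatorFormula_surfaceMeasure hU 𝒜 η⟩).mono_ac
      (withDensity_absolutelyContinuous _ _)
  have hw2 := memLp_two_of_bounded (μ := weightedMeasure S ρ) hK₀ hwm hwK hwM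
  refine ⟨hw2, ?_⟩
  have hopen : IsOpen (frontier U)ᶜ := isClosed_frontier.isOpen_compl
  have hnull : ∀ᵐ x, x ∉ frontier U := by
    simpa [ae_iff] using 𝒜.volume_frontier hU
  -- The assumptions control `∇f` only off `∂U`; setting it to zero on this null set makes the bound
  -- hold everywhere.
  set D : Space (n + 1) → Space (n + 1) := (frontier U)ᶜ.indicator (gradient f) with hD
  have hDf : D =ᵐ[volume] gradient f := by
    filter_upwards [hnull] with x hx
    exact indicator_of_mem (by exact hx) _
  have hDm : Measurable D := (measurable_gradient f).indicator hopen.measurableSet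
  obtain ⟨C, hC0, hC⟩ := hf.exists_bound
  obtain ⟨u, K, M, hu, hK, hK0, huK, hM, huM, hlim, hglim⟩ :=
    exists_testFunction_approximation (D := D) (C := C) hfc hfs hDm.aestronglyMeasurable
      (fun x => by
        by_cases hx : x ∈ (frontier U)ᶜ
        · rw [hD, indicator_of_mem hx, norm_gradient]
          exact (hC x hx).2.1
        · rw [hD, indicator_of_notMem hx, norm_zero]
          exact hC0)
      (fun x hx => by
        rw [hD, indicator_apply_eq_zero]
        exact fun _ => gradient_eq_zero_of_notMem_tsupport hx)
      (by
        filter_upwards [hnull] with x hx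
        have h : gradient f =ᶠ[𝓝 x] D := by
          filter_upwards [hopen.mem_nhds hx] with y hy
          exact (indicator_of_mem hy _).symm
        refine ContinuousAt.congr ?_ h
        exact ((InnerProductSpace.toDual ℝ (Space (n + 1))).symm.continuous.continuousAt).comp
          (hf.contDiffAt_fderiv hx).continuousAt)
      (fun ψ hψ hψs e => by
        rw [integral_fderiv_mul_eq_neg hf hU 𝒜 η hη hfc hψ hψs e]
        congr 1
        refine integral_congr_ae ?_
        filter_upwards [hDf] with x hx
        rw [hx])
  have hu2 : ∀ k, MemLp (u k) 2 (weightedMeasure S ρ) := fun k => (hu k).memLp _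
  have hul : Tendsto (fun k => (hu2 k).toLp (u k)) atTop (𝓝 (hf2.toLp f)) := by
    rw [Lp.tendsto_Lp_iff_tendsto_eLpNorm'']
    -- Dominated convergence for the full measure uses convergence at every point. The gradients
    -- below need it only almost everywhere, as the form carries no surface part.
    exact tendsto_eLpNorm_sub_of_bounded (C := M) hK (fun k => (hu2 k).1) hf2.1
      (fun k x hx => (huK k x hx).1) (fun x hx => (hK0 x hx).1)
      (fun k => Eventually.of_forall fun x => (huM k x).1)
      (Eventually.of_forall fun x => (hM x).1) (Eventually.of_forall hlim)
  have hD2 : MemLp D 2 (bulkMeasure ρ) := memLp_two_of_bounded hK hDm.aestronglyMeasurable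
    (fun x hx => (hK0 x hx).2) fun x => (hM x).2
  have hgl : Tendsto (fun k => (hu k).gradientLp hρ.continuous) atTop (𝓝 (hD2.toLp D)) := by
    refine (Lp.tendsto_Lp_iff_tendsto_eLpNorm'' (fun k => gradient (u k))
      (fun k => (hu k).memLp_gradient hρ.continuous) D hD2).2 ?_
    exact tendsto_eLpNorm_sub_of_bounded (C := M) hK
      (fun k => ((hu k).memLp_gradient hρ.continuous).1) hD2.1
      (fun k x hx => (huK k x hx).2) (fun x hx => (hK0 x hx).2)
      (fun k => Eventually.of_forall fun x => (huM k x).2)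
      (Eventually.of_forall fun x => (hM x).2) (hbulk.ae_le hglim)
  have happ : IsApproximation S ρ (hf2.toLp f) u := by
    refine ⟨hu, ⟨hu2, hul⟩, ?_⟩
    have h := (cauchySeq_iff_tendsto_dist_atTop_0.1 hgl.cauchySeq).pow 2
    rw [zero_pow two_ne_zero] at h
    exact h.congr fun p => ((hu p.1).preForm_sub_self hρ.continuous hpos (hu p.2)).symm
  refine isGeneratorValue_of_approximation hρ hpos happ hgl fun v hv hv2 => ?_
  have h1 : inner ℝ (hw2.toLp _) (hv2.toLp v) =
      ∫ x, generatorFormula U ρ f x * v x ∂(weightedMeasure S ρ) := by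
    rw [L2.inner_def]
    refine integral_congr_ae ?_
    filter_upwards [hw2.coeFn_toLp, hv2.coeFn_toLp] with x h1 h2
    rw [h1, h2]
    simp [mul_comm]
  rw [inner_neg_left, h1, ← integral_inner_gradient_eq hf hU hUb 𝒜 η hη hρ hpos hfs hv]
  refine (inner_toLp_bulkMeasure hρ.continuous hpos _ _).trans (integral_congr_ae ?_)
  filter_upwards [hDf] with x hx
  rw [hx]

end MainTheorem

end

/-- Here `d = n + 1 ≥ 2`. -/
theorem mainTheorem2 (n : ℕ) (hn : 1 ≤ n)
    (U : Set (Space (n + 1))) (hUo : IsOpen U) (hUb : Bornology.IsBounded U)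
    (𝒜 : LipschitzAtlas U)
    (η : SmoothPartitionOfUnity (Fin 𝒜.size) 𝓘(ℝ, Space (n + 1)) (Space (n + 1)) (frontier U))
    (hη : η.IsSubordinate fun k => (𝒜.chart k).nbhd)
    (ρ : Space (n + 1) → ℝ) (hρ : ContDiff ℝ 1 ρ) (hρ_pos : ∀ x, 0 < ρ x)
    (f : Space (n + 1) → ℝ) (hfc : Continuous f) (hfs : HasCompactSupport f)
    (hf : IsBoundedC2On f (frontier U)ᶜ) :
    (∀ x ∈ frontier U,
      (𝓝[U] x).NeBot ∧ Tendsto (gradient f) (𝓝[U] x) (𝓝 (gradientFrom U f x)) ∧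
      (𝓝[(closure U)ᶜ] x).NeBot ∧
      Tendsto (gradient f) (𝓝[(closure U)ᶜ] x) (𝓝 (gradientFrom (closure U)ᶜ f x))) ∧
    ∃ hf2 : MemLp f 2 (weightedMeasure (surfaceMeasure 𝒜 η) ρ),
      hf2.toLp f ∈ generatorDomain (surfaceMeasure 𝒜 η) ρ ∧
      generator (surfaceMeasure 𝒜 η) ρ (hf2.toLp f)
        =ᵐ[weightedMeasure (surfaceMeasure 𝒜 η) ρ] generatorFormula U ρ f := by
  refine ⟨fun x hx => ?_, ?_⟩
  · have hne := 𝒜.neBot_nhdsWithin hUo hx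
    have hlim := 𝒜.tendsto_gradientFrom hUo hf hx
    exact ⟨hne.1, hlim.1, hne.2, hlim.2⟩
  · have := isFiniteMeasureOnCompacts_weightedMeasure (surfaceMeasure 𝒜 η) hρ.continuous
    have hf2 : MemLp f 2 (weightedMeasure (surfaceMeasure 𝒜 η) ρ) :=
      hfc.memLp_of_hasCompactSupport hfs
    obtain ⟨hw2, hgen⟩ :=
      isGeneratorValue_generatorFormula hUo hUb 𝒜 η hη hρ hρ_pos hfc hfs hf hf2
    obtain ⟨hdom, hval⟩ := hgen.generator_eq hρ.continuous
    refine ⟨hf2, hdom, ?_⟩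
    rw [hval]
    exact hw2.coeFn_toLp
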